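/- **Setting.** Let $\mathcal A$ be a ring containing $\mathbb Q$ (i.e. a $\mathbb Q$-algebra, not necessarily commutative), $\kappa$ a ring automorphism of $\mathcal A$, and $\mathcal A_\kappa(\!(\tau)\!)$ the Novikov ring of formal series $\sum_{i\ge -N}a_i\tau^i$ with $a_i\in\mathcal A$ and $\tau^n a=\kappa^n(a)\tau^n$. Put $\mathcal Q_{\mathcal A,\kappa}=K_1(\mathcal A_\kappa(\!(\tau)\!))/\operatorname{im}K_1(\mathcal A)$. Let $W(\mathcal A,\kappa)$ be the group of units $1+a_1\tau+a_2\tau^2+\cdots$, let $W_1(\mathcal A,\kappa)\subset K_1(\mathcal A_\kappa[\![\tau]\!])$ be its image, also regarded as a subgroup of $\mathcal Q_{\mathcal A,\kappa}$ through the natural map. Let $P_n=\mathcal A\tau^n$, let $P_n'\subset P_n$ be the subgroup generated by the commutators $xy-yx$ with $x\in P_i$, $y\in P_{n-i}$, $0\le i\le n$, and $\bar P_n=P_n/P_n'$. For $w\in W(\mathcal A,\kappa)$ put $\log w=\sum_{r\ge1}(-1)^{r-1}(w-1)^r/r$, with $\tau^k$-coefficient taken in $\bar P_k$; for $q\in W_1(\mathcal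 A,\kappa)\subset\mathcal Q_{\mathcal A,\kappa}$, $\mathrm{Log}_k(q)\in\bar P_k$ is the $\tau^k$-coefficient of $\log w$ for any $w\in W(\mathcal A,\kappa)$ that represents $q$. Let $K\subset S^3$ be a tame knot and $F$ a bicollared Seifert surface of $K$ of genus $g$ for which $\pi_1(S^3\setminus F)$ is free of rank $2g$ (for instance a regular one), and let $\pi=\pi_1(S^3\setminus K,b)$. Choose free bases $u_1,\dots,u_{2g}$ of $\pi_1(F)$ (as provided by a spine $W$) and $x_1,\dots,x_{2g}$ of $\pi_1(S^3\setminus F)$, and arcs between the base points which cross $F$ once and close up to a meridian $\mathfrak m\in\pi$ of $K$. Let $y_j,z_j$ be the words in the $x_i$ that represent the push-offs $u_j^\flat,u_j^\sharp$ of $u_j$ to the lower and the upper side of $F$, so that $\mathfrak m y_j\mathfrak m^{-1}=z_j$ in $\pi$. A ring homomorphism $\rho:\mathbb Z[\pi]\to\mathcal A_\kappa(\!(\tau)\!)$ is *adapted* to these choices if $\rho(\mathfrak m)=\tau$ and $\rho(x_i)\in\mathcal A$ for all $i$. In that case let $A_{F,W}$ be the $2g\times 2g$ matrix whose entry in row $j$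 and column $i$ is $\tau\rho(\partial y_j/\partial x_i)-\rho(\partial z_j/\partial x_i)$ (Fox derivatives), and let $\Delta_\rho^{K_1}=[\tau]^{-g}[A_{F,W}]\in\mathcal Q_{\mathcal A,\kappa}$ if $A_{F,W}$ is invertible, and the neutral element of $\mathcal Q_{\mathcal A,\kappa}$ otherwise. Now let a second system of such choices for the same $F$ and $b$ be given, with meridian $\mathfrak m'$ (all of $u_i$, $x_i$ and the arcs may change as well), to which $\rho$ is also adapted after the change of indeterminate $\tau'=\rho(\mathfrak m')=c\tau$, $c\in\mathcal A^\times$. That is, with $\kappa'(a)=c\,\kappa(a)\,c^{-1}$ and the isomorphism $T:\mathcal A_{\kappa'}(\!(\tau')\!)\to\mathcal A_\kappa(\!(\tau)\!)$, $\sum a_n\tau'^n\mapsto\sum a_n(c\tau)^n$, there is $\rho'$ adapted to the second system with $T\circ\rho'=\rho$. Let $\Delta_{\rho'}^{K_1}\in\mathcal Q_{\mathcal A,\kappa'}$ be the invariant of $\rho'$ computed from the second system. **Proposition 4.3.** Suppose that $\tau^g\Delta_\rho^{K_1}$ lies in $W_1(\mathcal A,\kappa)$. Then $\tau'^g\Delta_{\rho'}^{K_1}$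 lies in $W_1(\mathcal A,\kappa')$, and for every $k\ge0$ the coefficients $\mathrm{Log}_k(\tau^g\Delta_\rho^{K_1})\in\bar P_k(\mathcal A,\kappa)$ and $\mathrm{Log}_k(\tau'^g\Delta_{\rho'}^{K_1})\in\bar P_k(\mathcal A,\kappa')$ are well defined and correspond to each other under the isomorphism $\bar P_k(\mathcal A,\kappa')\cong\bar P_k(\mathcal A,\kappa)$ induced by $T$. In other words, the $\tau^k$-coefficient of $\mathrm{Log}(\tau^g\Delta_\rho^{K_1})$ does not depend on the choice of the meridian, and is therefore an invariant of $\rho$. -/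

import Mathlib

noncomputable section

namespace KnotLog

/-! ### The Novikov ring (completed skew Laurent series) -/

section Novikov

variable {A : Type*} [Ring A]

/-- Two-sided sequences that vanish far to the left. -/
def boundedBelow (A : Type*) [Ring A] : AddSubgroup (ℤ → A) where
  carrier := {f | ∃ N : ℤ, ∀ n < N, f n = 0}
  zero_mem' := ⟨0, fun _ _ => rfl⟩
  add_mem' := by
    rintro f g ⟨N, hN⟩ ⟨M, hM⟩
    refine ⟨min N M, fun n hn => ?_⟩
    simp [hN n (lt_of_lt_of_le hn (min_le_left _ _)),
      hM n (lt_of_lt_of_le hn (min_le_right _ _))]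
  neg_mem' := by
    rintro f ⟨N, hN⟩
    exact ⟨N, fun n hn => by simp [hN n hn]⟩

/-- The Novikov ring `A_κ((τ))`: formal series `∑_{i ≥ -N} a_i τ^i` with `a_i ∈ A`,
multiplied by the rule `τ^n a = κ^n(a) τ^n`. -/
def Novikov (_κ : RingAut A) : Type _ := boundedBelow A

namespace Novikov

variable {κ : RingAut A}

instance : AddCommGroup (Novikov κ) := inferInstanceAs (AddCommGroup (boundedBelow A))

/-- The coefficient of `τ^n`. -/
def coeff (f : Novikov κ) (n : ℤ) : A := f.1 n

theorem bdd (f : Novikov κ) : ∃ N : ℤ, ∀ n < N, f.coeff n = 0 := f.2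

@[ext] theorem ext {f g : Novikov κ} (h : ∀ n, f.coeff n = g.coeff n) : f = g :=
  Subtype.ext (funext h)

/-- A series from its coefficients. -/
def mk (κ : RingAut A) (f : ℤ → A) (hf : ∃ N : ℤ, ∀ n < N, f n = 0) : Novikov κ := ⟨f, hf⟩

@[simp] theorem coeff_mk (f : ℤ → A) (hf) (n : ℤ) : (mk κ f hf).coeff n = f n := rfl
@[simp] theorem coeff_zero (n : ℤ) : (0 : Novikov κ).coeff n = 0 := rfl
@[simp] theorem coeff_add (f g : Novikov κ) (n : ℤ) :
    (f + g).coeff n = f.coeff n + g.coeff n := rfl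
@[simp] theorem coeff_neg (f : Novikov κ) (n : ℤ) : (-f).coeff n = -f.coeff n := rfl
@[simp] theorem coeff_sub (f g : Novikov κ) (n : ℤ) :
    (f - g).coeff n = f.coeff n - g.coeff n := rfl

/-- The coefficient of `τ^n` in a product; the sum has finitely many non-zero terms. -/
def mulCoeff (f g : Novikov κ) (n : ℤ) : A := ∑ᶠ i : ℤ, f.coeff i * (κ ^ i) (g.coeff (n - i))

theorem mulCoeff_eq_sum (f g : Novikov κ) {N M : ℤ} (hN : ∀ n < N, f.coeff n = 0)
    (hM : ∀ n < M, g.coeff n = 0) (n : ℤ) (s : Finset ℤ) (hs : Finset.Icc N (n - M) ⊆ s) :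
    mulCoeff f g n = ∑ i ∈ s, f.coeff i * (κ ^ i) (g.coeff (n - i)) := by
  refine finsum_eq_sum_of_support_subset _ fun i hi => ?_
  apply hs
  rw [Function.mem_support] at hi
  rw [Finset.mem_Icc]
  constructor
  · by_contra h
    exact hi (by rw [hN i (by omega), zero_mul])
  · by_contra h
    exact hi (by rw [hM (n - i) (by omega), map_zero, mul_zero])

instance : Mul (Novikov κ) where
  mul f g := mk κ (mulCoeff f g) (by
    obtain ⟨N, hN⟩ := f.bdd
    obtain ⟨M, hM⟩ := g.bdd
    refine ⟨N + M, fun n hn => ?_⟩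
    rw [mulCoeff_eq_sum f g hN hM n _ subset_rfl, Finset.Icc_eq_empty (by omega),
      Finset.sum_empty])

theorem coeff_mul (f g : Novikov κ) (n : ℤ) :
    (f * g).coeff n = ∑ᶠ i : ℤ, f.coeff i * (κ ^ i) (g.coeff (n - i)) := rfl

theorem coeff_mul_eq_sum (f g : Novikov κ) {N M : ℤ} (hN : ∀ n < N, f.coeff n = 0)
    (hM : ∀ n < M, g.coeff n = 0) (n : ℤ) (s : Finset ℤ) (hs : Finset.Icc N (n - M) ⊆ s) :
    (f * g).coeff n = ∑ i ∈ s, f.coeff i * (κ ^ i) (g.coeff (n - i)) :=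
  mulCoeff_eq_sum f g hN hM n s hs

theorem mul_bdd {f g : Novikov κ} {N M : ℤ} (hN : ∀ n < N, f.coeff n = 0)
    (hM : ∀ n < M, g.coeff n = 0) : ∀ n < N + M, (f * g).coeff n = 0 := fun n hn => by
  rw [coeff_mul_eq_sum f g hN hM n _ subset_rfl, Finset.Icc_eq_empty (by omega), Finset.sum_empty]

/-- The monomial `a τ^n`. -/
def monomial (κ : RingAut A) (n : ℤ) (a : A) : Novikov κ :=
  mk κ (Pi.single n a) ⟨n, fun m hm => by simp [hm.ne]⟩

theorem coeff_monomial (n m : ℤ) (a : A) :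
    (monomial κ n a).coeff m = if m = n then a else 0 := by
  simp [monomial, Pi.single_apply]

instance : One (Novikov κ) := ⟨monomial κ 0 1⟩

theorem one_def : (1 : Novikov κ) = monomial κ 0 1 := rfl

theorem coeff_monomial_mul (n m : ℤ) (a : A) (f : Novikov κ) :
    (monomial κ n a * f).coeff m = a * (κ ^ n) (f.coeff (m - n)) := by
  rw [coeff_mul, finsum_eq_single _ n]
  · simp [coeff_monomial]
  · intro i hi
    simp [coeff_monomial, hi]

theorem coeff_mul_monomial (n m : ℤ) (a : A) (f : Novikov κ) :
    (f * monomial κ n a).coeff m = f.coeff (m - n) * (κ ^ (m - n)) a := by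
  rw [coeff_mul, finsum_eq_single _ (m - n)]
  · simp [coeff_monomial]
  · intro i hi
    have : m - i ≠ n := by omega
    simp [coeff_monomial, this]

theorem monomial_mul_monomial (m n : ℤ) (a b : A) :
    monomial κ m a * monomial κ n b = monomial κ (m + n) (a * (κ ^ m) b) := by
  ext k
  rw [coeff_monomial_mul, coeff_monomial, coeff_monomial]
  by_cases h : k = m + n
  · simp [h]
  · have : k - m ≠ n := by omega
    simp [h, this]

theorem exists_common_bdd (f g : Novikov κ) :
    ∃ N : ℤ, (∀ n < N, f.coeff n = 0) ∧ ∀ n < N, g.coeff n = 0 := by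
  obtain ⟨N, hN⟩ := f.bdd
  obtain ⟨M, hM⟩ := g.bdd
  exact ⟨min N M, fun n hn => hN n (lt_of_lt_of_le hn (min_le_left _ _)),
    fun n hn => hM n (lt_of_lt_of_le hn (min_le_right _ _))⟩

theorem mul_assoc' (f g h : Novikov κ) : f * g * h = f * (g * h) := by
  obtain ⟨N, hN⟩ := f.bdd
  obtain ⟨M, hM⟩ := g.bdd
  obtain ⟨P, hP⟩ := h.bdd
  ext n
  rw [coeff_mul_eq_sum (f * g) h (mul_bdd hN hM) hP n _ subset_rfl,
    coeff_mul_eq_sum f (g * h) hN (mul_bdd hM hP) n (Finset.Icc N (n - M - P))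
      (by intro i; simp only [Finset.mem_Icc]; omega)]
  have h1 : ∀ k ∈ Finset.Icc (N + M) (n - P), (f * g).coeff k * (κ ^ k) (h.coeff (n - k)) =
      ∑ i ∈ Finset.Icc N (n - M - P),
        f.coeff i * (κ ^ i) (g.coeff (k - i)) * (κ ^ k) (h.coeff (n - k)) := by
    intro k hk
    rw [Finset.mem_Icc] at hk
    rw [coeff_mul_eq_sum f g hN hM k (Finset.Icc N (n - M - P))
      (by intro i; simp only [Finset.mem_Icc]; omega), Finset.sum_mul]
  rw [Finset.sum_congr rfl h1, Finset.sum_comm]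
  refine Finset.sum_congr rfl fun i hi => ?_
  rw [Finset.mem_Icc] at hi
  rw [coeff_mul_eq_sum g h hM hP (n - i) (Finset.Icc (N + M - i) (n - P - i))
      (by intro j; simp only [Finset.mem_Icc]; omega), map_sum, Finset.mul_sum]
  refine Finset.sum_nbij' (fun k => k - i) (fun j => j + i) ?_ ?_ ?_ ?_ ?_
  · intro k; simp only [Finset.mem_Icc]; omega
  · intro k; simp only [Finset.mem_Icc]; omega
  · intro k _; simp
  · intro k _; simp
  · intro k _
    have e1 : (κ ^ k) (h.coeff (n - k)) = (κ ^ i) ((κ ^ (k - i)) (h.coeff (n - i - (k - i)))) := by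
      rw [← RingAut.mul_apply, ← zpow_add, show i + (k - i) = k by ring,
        show n - i - (k - i) = n - k by ring]
    rw [e1, map_mul, mul_assoc]

instance : Ring (Novikov κ) where
  __ := (inferInstance : AddCommGroup (Novikov κ))
  mul_assoc := mul_assoc'
  one_mul f := by ext n; simp [one_def, coeff_monomial_mul]
  mul_one f := by ext n; simp [one_def, coeff_mul_monomial]
  zero_mul f := by ext n; simp [coeff_mul]
  mul_zero f := by ext n; simp [coeff_mul]
  left_distrib f g h := by
    obtain ⟨N, hN⟩ := f.bdd
    obtain ⟨M, hM, hM'⟩ := exists_common_bdd g h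
    ext n
    rw [coeff_add, coeff_mul_eq_sum f g hN hM n _ subset_rfl,
      coeff_mul_eq_sum f h hN hM' n _ subset_rfl,
      coeff_mul_eq_sum f (g + h) hN (M := M) (fun k hk => by simp [hM k hk, hM' k hk]) n _
        subset_rfl, ← Finset.sum_add_distrib]
    simp [mul_add]
  right_distrib f g h := by
    obtain ⟨M, hM⟩ := h.bdd
    obtain ⟨N, hN, hN'⟩ := exists_common_bdd f g
    ext n
    rw [coeff_add, coeff_mul_eq_sum f h hN hM n _ subset_rfl,
      coeff_mul_eq_sum g h hN' hM n _ subset_rfl,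
      coeff_mul_eq_sum (f + g) h (N := N) (fun k hk => by simp [hN k hk, hN' k hk]) hM n _
        subset_rfl, ← Finset.sum_add_distrib]
    simp [add_mul]

/-- The inclusion `A → A_κ((τ))` as constant series. -/
def C (κ : RingAut A) : A →+* Novikov κ where
  toFun a := monomial κ 0 a
  map_one' := rfl
  map_mul' a b := by simp [monomial_mul_monomial]
  map_zero' := by ext n; simp [coeff_monomial]
  map_add' a b := by ext n; by_cases h : n = 0 <;> simp [coeff_monomial, h]

/-- The indeterminate `τ`, as a unit of `A_κ((τ))`. -/
def τ (κ : RingAut A) : (Novikov κ)ˣ where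
  val := monomial κ 1 1
  inv := monomial κ (-1) 1
  val_inv := by simp [monomial_mul_monomial, one_def]
  inv_val := by simp [monomial_mul_monomial, one_def]

/-- The subring `A_κ[[τ]]` of power series. -/
def powerSeries (κ : RingAut A) : Subring (Novikov κ) where
  carrier := {f | ∀ n < 0, f.coeff n = 0}
  mul_mem' hf hg n hn := mul_bdd hf hg n (by omega)
  one_mem' n hn := by simp [one_def, coeff_monomial, hn.ne]
  add_mem' hf hg n hn := by simp [hf n hn, hg n hn]
  zero_mem' n _ := coeff_zero n
  neg_mem' hf n hn := by simp [hf n hn]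

theorem coeff_zero_mul {f g : Novikov κ} (hf : f ∈ powerSeries κ) (hg : g ∈ powerSeries κ) :
    (f * g).coeff 0 = f.coeff 0 * g.coeff 0 := by
  rw [coeff_mul_eq_sum f g hf hg 0 {0} (by simp)]
  simp

/-- The group `W(A, κ)` of Witt vectors: the units `1 + a₁ τ + a₂ τ² + ⋯` of `A_κ[[τ]]`. -/
def witt (κ : RingAut A) : Subgroup (powerSeries κ)ˣ where
  carrier := {w | (w : powerSeries κ).1.coeff 0 = 1}
  mul_mem' {v w} hv hw := by
    simp only [Set.mem_ofPred_eq] at hv hw ⊢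
    rw [Units.val_mul, Subring.coe_mul, coeff_zero_mul v.1.2 w.1.2, hv, hw, one_mul]
  one_mem' := by simp [one_def, coeff_monomial]
  inv_mem' {w} hw := by
    simp only [Set.mem_ofPred_eq] at hw ⊢
    have h : ((w : powerSeries κ) * (w⁻¹ : (powerSeries κ)ˣ) : powerSeries κ).1.coeff 0 = 1 := by
      rw [Units.mul_inv]; simp [one_def, coeff_monomial]
    rwa [Subring.coe_mul, coeff_zero_mul w.1.2 (w⁻¹).1.2, hw, one_mul] at h

/-! ### The groups `P̄_n` and the logarithm -/

/-- `P_n = A τ^n`, as an additive subgroup of `A_κ((τ))`. -/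
def P (κ : RingAut A) (n : ℕ) : AddSubgroup (Novikov κ) where
  carrier := Set.range (monomial κ n)
  zero_mem' := ⟨0, by ext k; simp [coeff_monomial]⟩
  add_mem' := by
    rintro _ _ ⟨a, rfl⟩ ⟨b, rfl⟩
    exact ⟨a + b, by ext k; by_cases h : k = n <;> simp [coeff_monomial, h]⟩
  neg_mem' := by
    rintro _ ⟨a, rfl⟩
    exact ⟨-a, by ext k; by_cases h : k = n <;> simp [coeff_monomial, h]⟩

/-- `P'_n`, generated by all commutators `x y - y x` with `x ∈ P_i`, `y ∈ P_{n - i}`. -/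
def P' (κ : RingAut A) (n : ℕ) : AddSubgroup (Novikov κ) :=
  AddSubgroup.closure {z | ∃ i j : ℕ, i + j = n ∧ ∃ x ∈ P κ i, ∃ y ∈ P κ j, z = x * y - y * x}

/-- `P̄_n = P_n / P'_n`. -/
abbrev Pbar (κ : RingAut A) (n : ℕ) : Type _ := P κ n ⧸ (P' κ n).addSubgroupOf (P κ n)

/-- The class in `P̄_n` of the monomial `a τ^n`. -/
def Pbar.mk (κ : RingAut A) (n : ℕ) (a : A) : Pbar κ n :=
  QuotientAddGroup.mk (⟨monomial κ n a, a, rfl⟩ : P κ n)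

/-- The `τ^k`-coefficient, in `P̄_k`, of `log w = ∑_{r ≥ 1} (-1)^(r-1) (w - 1)^r / r` for
`w ∈ W(A, κ)`. Only the terms with `r ≤ k` contribute to `τ^k`. -/
def logCoeff [Algebra ℚ A] (k : ℕ) (w : witt κ) : Pbar κ k :=
  Pbar.mk κ k (∑ r ∈ Finset.Icc 1 k,
    ((-1) ^ (r - 1) / r : ℚ) • ((((w.1 : powerSeries κ) : Novikov κ) - 1) ^ r).coeff k)

/-! ### Changing the indeterminate -/

/-- The automorphism `a ↦ c κ(a) c⁻¹`, which is conjugation by `c τ` on `A ⊆ A_κ((τ))`. -/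
def twist (κ : RingAut A) (c : Aˣ) : RingAut A :=
  MulSemiringAction.toRingAut (ConjAct Aˣ) A (ConjAct.toConjAct c) * κ

theorem twist_apply (κ : RingAut A) (c : Aˣ) (a : A) :
    twist κ c a = c * κ a * (c⁻¹ : Aˣ) := rfl

/-- `κ` acting on the unit group of `A`, as an action of `ℤ`. -/
def unitsAction (κ : RingAut A) : Multiplicative ℤ →* MulAut Aˣ :=
  zpowersHom (MulAut Aˣ) (Units.mapEquiv (κ : A ≃* A))

theorem unitsAction_apply (κ : RingAut A) (n : ℤ) (u : Aˣ) :
    ((unitsAction κ (Multiplicative.ofAdd n) u : Aˣ) : A) = (κ ^ n) (u : A) := by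
  have key : ∀ n : ℤ, ((unitsAction κ (Multiplicative.ofAdd n)) : MulAut Aˣ) =
      Units.mapEquiv ((κ ^ n : RingAut A) : A ≃* A) := by
    intro n
    rw [unitsAction, zpowersHom_apply, toAdd_ofAdd]
    let ψ : RingAut A →* MulAut Aˣ :=
      { toFun := fun e => Units.mapEquiv (e : A ≃* A)
        map_one' := by ext; rfl
        map_mul' := fun _ _ => by ext; rfl }
    exact (map_zpow ψ κ n).symm
  rw [key]
  rfl

/-- The coefficient `N_n(c)` in `(c τ)^n = N_n(c) τ^n`, for `n ∈ ℤ`; it is read off from the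
power `(c, 1)^n` in the semidirect product `Aˣ ⋊ ℤ`. -/
def normUnit (κ : RingAut A) (c : Aˣ) (n : ℤ) : Aˣ :=
  ((⟨c, Multiplicative.ofAdd 1⟩ : Aˣ ⋊[unitsAction κ] Multiplicative ℤ) ^ n).left

theorem normUnit_zero (κ : RingAut A) (c : Aˣ) : normUnit κ c 0 = 1 := by
  simp [normUnit]

theorem normUnit_one (κ : RingAut A) (c : Aˣ) : normUnit κ c 1 = c := by
  simp [normUnit]

theorem normUnit_add (κ : RingAut A) (c : Aˣ) (m n : ℤ) :
    (normUnit κ c (m + n) : A) = normUnit κ c m * (κ ^ m) (normUnit κ c n : A) := by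
  have hr : ((⟨c, Multiplicative.ofAdd 1⟩ : Aˣ ⋊[unitsAction κ] Multiplicative ℤ) ^ m).right =
      Multiplicative.ofAdd m := by
    rw [← SemidirectProduct.rightHom_eq_right, map_zpow]
    simp [← ofAdd_zsmul]
  rw [normUnit, zpow_add, SemidirectProduct.mul_left, hr, Units.val_mul, unitsAction_apply]
  rfl

theorem twist_zpow_mul (κ : RingAut A) (c : Aˣ) (n : ℤ) (a : A) :
    ((twist κ c) ^ n) a * normUnit κ c n = normUnit κ c n * (κ ^ n) a := by
  have step : ∀ (n : ℤ) (a : A), twist κ c a * c = c * κ a := by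
    intro n a; rw [twist_apply]; simp [mul_assoc]
  have e1 : ∀ n : ℤ, (normUnit κ c (n + 1) : A) = normUnit κ c n * (κ ^ n) (c : A) := by
    intro n; rw [normUnit_add, normUnit_one]
  induction n using Int.induction_on generalizing a with
  | zero => simp [normUnit_zero]
  | succ n ih =>
    rw [e1, zpow_add, zpow_add, zpow_one, zpow_one, RingAut.mul_apply, RingAut.mul_apply,
      ← mul_assoc, ih, mul_assoc, ← map_mul, step 0, map_mul, mul_assoc]
  | pred n ih =>
    have h := e1 (-(n : ℤ) - 1)
    rw [show -(n : ℤ) - 1 + 1 = -n by ring] at h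
    have hu : IsUnit ((κ ^ (-(n : ℤ) - 1)) (c : A)) := (c.isUnit).map _
    refine hu.mul_right_cancel ?_
    have h2 : (twist κ c ^ (-(n : ℤ) - 1)) a = (twist κ c ^ (-(n : ℤ))) ((twist κ c)⁻¹ a) := by
      rw [← RingAut.mul_apply, ← zpow_neg_one (twist κ c), ← zpow_add]; rfl
    have h3 : (κ ^ (-(n : ℤ))) ((twist κ c)⁻¹ a) =
        (κ ^ (-(n : ℤ) - 1)) (κ ((twist κ c)⁻¹ a)) := by
      have e : κ ^ (-(n : ℤ)) = κ ^ (-(n : ℤ) - 1) * κ := by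
        rw [← zpow_add_one, show -(n : ℤ) - 1 + 1 = -n by ring]
      rw [e]; rfl
    have h4 : a * c = c * κ ((twist κ c)⁻¹ a) := by
      rw [← step 0, ← RingAut.mul_apply, mul_inv_cancel]; rfl
    rw [mul_assoc, ← h, h2, ih, h3, h, mul_assoc, mul_assoc, ← map_mul, ← map_mul, h4]

/-- The substitution `τ' ↦ c τ`: the ring homomorphism `A_κ'((τ')) → A_κ((τ))`,
`∑ a_n τ'^n ↦ ∑ a_n (c τ)^n`, where `κ'(a) = c κ(a) c⁻¹`. It is the identity on `A`. -/
def subst (κ : RingAut A) (c : Aˣ) : Novikov (twist κ c) →+* Novikov κ where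
  toFun f := mk κ (fun n => f.coeff n * normUnit κ c n) (by
    obtain ⟨N, hN⟩ := f.bdd
    exact ⟨N, fun n hn => by simp [hN n hn]⟩)
  map_one' := by
    ext n
    by_cases h : n = 0 <;> simp [one_def, coeff_monomial, h, normUnit_zero]
  map_mul' f g := by
    obtain ⟨N, hN⟩ := f.bdd
    obtain ⟨M, hM⟩ := g.bdd
    ext n
    rw [coeff_mk, coeff_mul_eq_sum f g hN hM n _ subset_rfl,
      coeff_mul_eq_sum _ _ (N := N) (M := M) (fun k hk => by simp [hN k hk])
        (fun k hk => by simp [hM k hk]) n _ subset_rfl, Finset.sum_mul]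
    refine Finset.sum_congr rfl fun i _ => ?_
    have hn : (normUnit κ c n : A) = normUnit κ c i * (κ ^ i) (normUnit κ c (n - i) : A) := by
      rw [← normUnit_add, add_sub_cancel]
    rw [coeff_mk, coeff_mk, map_mul, hn, mul_assoc, mul_assoc,
      ← mul_assoc _ (normUnit κ c i : A), twist_zpow_mul, mul_assoc]
  map_zero' := by ext n; simp
  map_add' f g := by ext n; simp [add_mul]

@[simp] theorem coeff_subst (κ : RingAut A) (c : Aˣ) (f : Novikov (twist κ c)) (n : ℤ) :
    (subst κ c f).coeff n = f.coeff n * normUnit κ c n := rfl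

theorem subst_C (κ : RingAut A) (c : Aˣ) (a : A) : subst κ c (C _ a) = C κ a := by
  ext n
  by_cases h : n = 0 <;> simp [C, coeff_monomial, h, normUnit_zero]

theorem subst_τ (κ : RingAut A) (c : Aˣ) :
    subst κ c (τ (twist κ c) : Novikov (twist κ c)) = C κ c * (τ κ : Novikov κ) := by
  have h : C κ (c : A) * (τ κ : Novikov κ) = monomial κ 1 c := by
    simp [C, τ, monomial_mul_monomial]
  rw [h]
  ext n
  by_cases h : n = 1 <;> simp [τ, coeff_monomial, h, normUnit_one]

theorem subst_mem_P (κ : RingAut A) (c : Aˣ) {n : ℕ} {x : Novikov (twist κ c)}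
    (hx : x ∈ P (twist κ c) n) : subst κ c x ∈ P κ n := by
  obtain ⟨a, rfl⟩ := hx
  refine ⟨a * normUnit κ c n, ?_⟩
  ext k
  by_cases h : k = n <;> simp [coeff_monomial, h]

theorem subst_mem_P' (κ : RingAut A) (c : Aˣ) {n : ℕ} {x : Novikov (twist κ c)}
    (hx : x ∈ P' (twist κ c) n) : subst κ c x ∈ P' κ n := by
  induction hx using AddSubgroup.closure_induction with
  | mem x hx =>
    obtain ⟨i, j, hij, y, hy, z, hz, rfl⟩ := hx
    exact AddSubgroup.subset_closure
      ⟨i, j, hij, _, subst_mem_P κ c hy, _, subst_mem_P κ c hz, by simp⟩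
  | zero => rw [map_zero]; exact zero_mem _
  | add x y _ _ hx hy => rw [map_add]; exact add_mem hx hy
  | neg x _ hx => rw [map_neg]; exact neg_mem hx

/-- The identification of `P̄_n` for the indeterminate `τ'` with `P̄_n` for the indeterminate `τ`,
the class of `a τ'^n` going to the class of `a (c τ)^n`. -/
def Pbar.subst (κ : RingAut A) (c : Aˣ) (n : ℕ) : Pbar (twist κ c) n →+ Pbar κ n :=
  QuotientAddGroup.map _ _
    (((Novikov.subst κ c : Novikov (twist κ c) →+ Novikov κ).comp
      (P (twist κ c) n).subtype).codRestrict (P κ n) fun x => subst_mem_P κ c x.2)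
    fun x hx => subst_mem_P' κ c (x := x) hx

end Novikov

end Novikov

/-! ### The group `K₁` -/

section K1

variable (R S : Type*) [Ring R] [Ring S]

/-- `GL_n(R)`. -/
abbrev GLn (n : ℕ) : Type _ := (Matrix (Fin n) (Fin n) R)ˣ

variable {R} in
/-- The square matrix of size `n` with `M` in the upper left corner, completed by an identity
block. -/
def stabMatrix {m : ℕ} (n : ℕ) (M : Matrix (Fin m) (Fin m) R) : Matrix (Fin n) (Fin n) R :=
  fun i j => if h : (i : ℕ) < m ∧ (j : ℕ) < m then M ⟨i, h.1⟩ ⟨j, h.2⟩ else if i = j then 1 else 0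

variable {R} in
theorem stabMatrix_one {m n : ℕ} : stabMatrix n (1 : Matrix (Fin m) (Fin m) R) = 1 := by
  ext i j
  by_cases h : (i : ℕ) < m ∧ (j : ℕ) < m
  · simp [stabMatrix, h, Matrix.one_apply, Fin.ext_iff]
  · simp [stabMatrix, h, Matrix.one_apply]

variable {R} in
theorem stabMatrix_mul {m n : ℕ} (hmn : m ≤ n) (M N : Matrix (Fin m) (Fin m) R) :
    stabMatrix n (M * N) = stabMatrix n M * stabMatrix n N := by
  ext i j
  rw [Matrix.mul_apply]
  by_cases hi : (i : ℕ) < m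
  · by_cases hj : (j : ℕ) < m
    · have h1 : ∀ k : Fin n, stabMatrix n M i k * stabMatrix n N k j =
          if h : (k : ℕ) < m then M ⟨i, hi⟩ ⟨k, h⟩ * N ⟨k, h⟩ ⟨j, hj⟩ else 0 := by
        intro k
        by_cases hk : (k : ℕ) < m
        · simp [stabMatrix, hi, hj, hk]
        · have : i ≠ k := fun h => hk (h ▸ hi)
          simp [stabMatrix, hk, this]
      rw [Finset.sum_congr rfl fun k _ => h1 k]
      simp only [stabMatrix, hi, hj, and_self, dite_true, Matrix.mul_apply]
      rw [← Finset.sum_subset (Finset.subset_univ (Finset.univ.map (Fin.castLEEmb hmn)))]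
      · rw [Finset.sum_map]; simp
      · intro k _ hk
        have : ¬ (k : ℕ) < m := fun h => hk (by
          rw [Finset.mem_map]; exact ⟨⟨k, h⟩, Finset.mem_univ _, rfl⟩)
        simp [this]
    · rw [Finset.sum_eq_single j]
      · simp [stabMatrix, hj]
      · intro k _ hk; simp [stabMatrix, hj, hk]
      · simp
  · rw [Finset.sum_eq_single i]
    · simp [stabMatrix, hi]
    · intro k _ hk; simp [stabMatrix, hi, hk.symm]
    · simp

/-- The stabilization `GL_m(R) → GL_n(R)`, `m ≤ n`. -/
def stab {m n : ℕ} (h : m ≤ n) : GLn R m →* GLn R n :=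
  Units.map
    { toFun := stabMatrix n
      map_one' := stabMatrix_one
      map_mul' := stabMatrix_mul h }

theorem stab_apply {m n : ℕ} (h : m ≤ n) (M : GLn R m) :
    (stab R h M : Matrix (Fin n) (Fin n) R) = stabMatrix n (M : Matrix (Fin m) (Fin m) R) := rfl

instance : DirectedSystem (GLn R) (fun _ _ h => stab R h) where
  map_self i x := by
    apply Units.ext
    ext a b
    simp [stab_apply, stabMatrix]
  map_map k j i hij hjk x := by
    apply Units.ext
    ext a b
    simp only [stab_apply, stabMatrix]
    split_ifs <;> first | rfl | omega | simp_all [Fin.ext_iff]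

/-- The stable general linear group `GL(R) = colim GL_n(R)`. -/
abbrev GLstable : Type _ := DirectLimit (GLn R) (fun _ _ h => stab R h)

/-- `K₁(R)`, the abelianization of `GL(R)`. -/
abbrev K1 : Type _ := Abelianization (GLstable R)

namespace K1

variable {R S}

/-- The class in `K₁(R)` of an invertible matrix. -/
def ofGL (n : ℕ) : GLn R n →* K1 R :=
  Abelianization.of.comp
    { toFun := fun M => (⟦⟨n, M⟩⟧ : GLstable R)
      map_one' := (DirectLimit.one_def n).symm
      map_mul' := fun M N => (DirectLimit.mul_def n M N).symm }

/-- The class in `K₁(R)` of a unit of `R`, seen as a `1 × 1` matrix. -/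
def ofUnit : Rˣ →* K1 R := (ofGL 1).comp (Units.map (Matrix.scalar (Fin 1)).toMonoidHom)

/-- `GL_n` of a ring homomorphism. -/
def mapGL (f : R →+* S) (n : ℕ) : GLn R n →* GLn S n := Units.map f.mapMatrix.toMonoidHom

theorem mapGL_stab (f : R →+* S) {m n : ℕ} (h : m ≤ n) (M : GLn R m) :
    stab S h (mapGL f m M) = mapGL f n (stab R h M) := by
  apply Units.ext
  ext i j
  change stabMatrix n (f.mapMatrix (M : Matrix (Fin m) (Fin m) R)) i j =
    f (stabMatrix n (M : Matrix (Fin m) (Fin m) R) i j)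
  simp only [stabMatrix]
  split_ifs <;> simp

/-- `K₁` of a ring homomorphism. -/
def map (f : R →+* S) : K1 R →* K1 S :=
  Abelianization.map
    { toFun := DirectLimit.map _ _ (fun n => mapGL f n) fun _ _ h M => mapGL_stab f h M
      map_one' := by
        rw [DirectLimit.one_def 0, DirectLimit.map_def, DirectLimit.one_def 0, map_one]
      map_mul' := DirectLimit.induction₂ _ fun n M N => by
        simp only [DirectLimit.mul_def, DirectLimit.map_def, map_mul] }

theorem map_ofGL (f : R →+* S) (n : ℕ) (M : GLn R n) :
    map f (ofGL n M) = ofGL n (mapGL f n M) := rfl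

end K1

end K1

section Quotient

variable {A : Type*} [Ring A] (κ : RingAut A)

open Novikov

/-- `Q_{A,κ} = K₁(A_κ((τ))) / K₁(A)`. -/
abbrev Q : Type _ := K1 (Novikov κ) ⧸ (K1.map (C κ)).range

/-- The natural map `J : W(A, κ) → K₁(A_κ[[τ]])`. -/
def wittToK1 : witt κ →* K1 (powerSeries κ) := K1.ofUnit.comp (witt κ).subtype

/-- `W₁(A, κ)`, the subgroup of `K₁(A_κ[[τ]])` represented by Witt vectors. -/
def W1 : Subgroup (K1 (powerSeries κ)) := (wittToK1 κ).range

/-- The natural map `K₁(A_κ[[τ]]) → K₁(A_κ((τ))) → Q_{A,κ}`. -/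
def toQ : K1 (powerSeries κ) →* Q κ :=
  (QuotientGroup.mk' _).comp (K1.map (powerSeries κ).subtype)

/-- An element of `Q_{A,κ}` lies in `W₁(A, κ)`, the latter being regarded as a subgroup of
`Q_{A,κ}` through the natural map. -/
def LiesInW1 (q : Q κ) : Prop := q ∈ (W1 κ).map (toQ κ)

/-- `ℓ ∈ P̄_k` is a value of the `τ^k`-coefficient of the logarithm `Log q`: `q` is the class of an
element `J(w)` of `W₁(A, κ)` with `w ∈ W(A, κ)`, and `ℓ` is the `τ^k`-coefficient of `log w`. -/
def IsLogCoeff [Algebra ℚ A] (k : ℕ) (q : Q κ) (ℓ : Pbar κ k) : Prop :=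
  ∃ w : witt κ, toQ κ (wittToK1 κ w) = q ∧ logCoeff k w = ℓ

end Quotient

/-! ### The Fox derivative -/

section Fox

variable {ι : Type*} [DecidableEq ι]

/-- The homomorphism `h ↦ (h, ∂h/∂x_i ; 0, 1)` from the free group to upper triangular matrices
over its integral group ring. -/
def foxHom (i : ι) : FreeGroup ι →* (Matrix (Fin 2) (Fin 2) (MonoidAlgebra ℤ (FreeGroup ι)))ˣ :=
  FreeGroup.lift fun j =>
    { val := !![MonoidAlgebra.of ℤ _ (FreeGroup.of j), if j = i then 1 else 0; 0, 1]
      inv := !![MonoidAlgebra.of ℤ _ (FreeGroup.of j)⁻¹,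
        if j = i then -MonoidAlgebra.of ℤ _ (FreeGroup.of j)⁻¹ else 0; 0, 1]
      val_inv := by
        rw [Matrix.mul_fin_two, Matrix.one_fin_two]
        split_ifs <;> simp [MonoidAlgebra.single_mul_single, MonoidAlgebra.one_def]
      inv_val := by
        rw [Matrix.mul_fin_two, Matrix.one_fin_two]
        split_ifs <;> simp [MonoidAlgebra.single_mul_single, MonoidAlgebra.one_def] }

/-- The Fox derivative `∂h/∂x_i ∈ ℤ[F]` of an element `h` of the free group `F`. -/
def fox (i : ι) (h : FreeGroup ι) : MonoidAlgebra ℤ (FreeGroup ι) := (foxHom i h).val 0 1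

theorem fox_of (i j : ι) : fox i (FreeGroup.of j) = if j = i then 1 else 0 := by
  simp [fox, foxHom]

theorem foxHom_row (i : ι) (h : FreeGroup ι) :
    (foxHom i h).val 0 0 = MonoidAlgebra.of ℤ _ h ∧ (foxHom i h).val 1 0 = 0 ∧
      (foxHom i h).val 1 1 = 1 := by
  induction h using FreeGroup.induction_on with
  | C1 => simp [MonoidAlgebra.one_def]
  | of j => simp [foxHom]
  | inv_of j _ => rw [map_inv]; simp [foxHom]
  | mul x y hx hy =>
    obtain ⟨hx1, hx2, hx3⟩ := hx
    obtain ⟨hy1, hy2, hy3⟩ := hy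
    rw [map_mul, Units.val_mul]
    simp only [Matrix.mul_apply, Fin.sum_univ_two, hx1, hx2, hx3, hy1, hy2, hy3]
    simp [MonoidAlgebra.single_mul_single]

theorem fox_mul (i : ι) (h k : FreeGroup ι) :
    fox i (h * k) = fox i h + MonoidAlgebra.of ℤ _ h * fox i k := by
  obtain ⟨h1, h2, h3⟩ := foxHom_row i h
  obtain ⟨k1, k2, k3⟩ := foxHom_row i k
  rw [fox, map_mul, Units.val_mul, Matrix.mul_apply, Fin.sum_univ_two, h1, k3, mul_one, add_comm]
  rfl

end Fox

/-! ### Fundamental groups -/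

section Pi1

variable {X Y : Type*} [TopologicalSpace X] [TopologicalSpace Y]

/-- The fundamental group with the usual order of multiplication: `[p] * [q]` is the class of the
loop that runs first along `p` and then along `q`. (In `FundamentalGroup` it is the opposite.) -/
abbrev Pi1 (X : Type*) [TopologicalSpace X] (x : X) : Type _ := (FundamentalGroup X x)ᵐᵒᵖ

namespace Pi1

/-- The class of a loop. -/
def ofLoop {x : X} (p : Path x x) : Pi1 X x :=
  MulOpposite.op (FundamentalGroup.fromPath (Path.Homotopic.Quotient.mk p))

theorem ofLoop_mul {x : X} (p q : Path x x) : ofLoop p * ofLoop q = ofLoop (p.trans q) := rfl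

/-- The class `[α · w · α⁻¹]` at `x`, for a path `α` from `x` to `y` and a class `w` at `y`. -/
def transport {x y : X} (α : Path x y) (w : Pi1 X y) : Pi1 X x :=
  MulOpposite.op (FundamentalGroup.fromPath
    ((Path.Homotopic.Quotient.mk α).trans
      ((FundamentalGroup.toPath w.unop).trans (Path.Homotopic.Quotient.mk α).symm)))

theorem transport_ofLoop {x y : X} (α : Path x y) (p : Path y y) :
    transport α (ofLoop p) = ofLoop (α.trans (p.trans α.symm)) := rfl

/-- The homomorphism induced by a continuous map. -/
def map (f : C(X, Y)) (x : X) : Pi1 X x →* Pi1 Y (f x) := (FundamentalGroup.map f x).op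

theorem map_ofLoop (f : C(X, Y)) {x : X} (p : Path x x) :
    map f x (ofLoop p) = ofLoop (p.map f.continuous) := rfl

end Pi1

end Pi1

/-! ### Knots, meridians and Seifert surfaces -/

/-- The three-sphere. -/
abbrev Sphere3 : Type := Metric.sphere (0 : EuclideanSpace ℝ (Fin 4)) 1

/-- The closed unit disc. -/
abbrev Disc : Type := Metric.closedBall (0 : ℂ) 1

/-- The inclusion of the boundary circle of the disc. -/
def circleToDisc : C(Circle, Disc) where
  toFun z := ⟨z, by rw [mem_closedBall_zero_iff]; exact (Circle.norm_coe z).le⟩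
  continuous_toFun := by fun_prop

/-- A tame knot in `S³`: the core of an embedded solid torus `S¹ × D² → S³`. The solid torus
(a tubular neighbourhood) also fixes the sense in which meridians run around the knot. -/
structure Knot where
  tube : C(Circle × Disc, Sphere3)
  injective : Function.Injective tube

namespace Knot

variable (K : Knot)

/-- The knot as a subset of `S³`. -/
def carrier : Set Sphere3 := Set.range fun θ : Circle => K.tube (θ, ⟨0, by simp⟩)

/-- The complement `S³ \ K`. -/
abbrev Complement : Type := {x : Sphere3 // x ∉ K.carrier}

theorem tube_notMem (θ z : Circle) : K.tube (θ, circleToDisc z) ∉ K.carrier := by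
  rintro ⟨θ', h⟩
  have h2 := congrArg (fun q : Circle × Disc => (q.2 : ℂ)) (K.injective h)
  exact Circle.coe_ne_zero z h2.symm

/-- The boundary of a meridian disc of the tubular neighbourhood. -/
def meridianLoop (θ : Circle) :
    Path (⟨K.tube (θ, circleToDisc 1), K.tube_notMem θ 1⟩ : K.Complement)
      ⟨K.tube (θ, circleToDisc 1), K.tube_notMem θ 1⟩ where
  toFun t := ⟨K.tube (θ, circleToDisc (Circle.exp (2 * Real.pi * t))), K.tube_notMem θ _⟩
  continuous_toFun := by fun_prop
  source' := by simp
  target' := by simp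

/-- The knot group `π₁(S³ \ K, b)`. -/
abbrev group (b : K.Complement) : Type := Pi1 K.Complement b

/-- Meridians: the loops that run from the base point to the boundary of the tubular
neighbourhood, once around a meridian disc, and back along the same path. -/
def IsMeridian {b : K.Complement} (m : K.group b) : Prop :=
  ∃ (θ : Circle) (γ : Path b ⟨K.tube (θ, circleToDisc 1), K.tube_notMem θ 1⟩),
    m = Pi1.transport γ (Pi1.ofLoop (K.meridianLoop θ))

end Knot

/-- The point with parameter `t ∈ ℝ / (4g+1)` on the boundary of the disc, which is divided into
`4g+1` edges `[n, n+1]`. -/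
def polygonPoint (g : ℕ) (t : ℝ) : Disc :=
  circleToDisc (Circle.exp (2 * Real.pi * t / (4 * g + 1)))

/-- The gluing of the edges of the `(4g+1)`-gon according to the word
`a₁ b₁ a₁⁻¹ b₁⁻¹ ⋯ a_g b_g a_g⁻¹ b_g⁻¹ d`. -/
inductive SurfaceRel (g : ℕ) : Disc → Disc → Prop
  | glueA (j : ℕ) (hj : j < g) (s : ℝ) (hs : s ∈ Set.Icc (0 : ℝ) 1) :
      SurfaceRel g (polygonPoint g (4 * j + s)) (polygonPoint g (4 * j + 3 - s))
  | glueB (j : ℕ) (hj : j < g) (s : ℝ) (hs : s ∈ Set.Icc (0 : ℝ) 1) :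
      SurfaceRel g (polygonPoint g (4 * j + 1 + s)) (polygonPoint g (4 * j + 4 - s))

/-- The compact connected oriented surface `Σ_{g,1}` of genus `g` with one boundary circle, as a
polygon with glued edges. -/
abbrev Surface (g : ℕ) : Type := Quot (SurfaceRel g)

/-- The boundary circle of `Σ_{g,1}`: the image of the edge `d`, whose end points are
identified. -/
def surfaceBoundary (g : ℕ) : Set (Surface g) :=
  (fun t : ℝ => Quot.mk (SurfaceRel g) (polygonPoint g t)) '' Set.Icc (4 * g : ℝ) (4 * g + 1)

/-- The interior of `Σ_{g,1}`. It has the same fundamental group as `Σ_{g,1}`. -/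
abbrev SurfaceInterior (g : ℕ) : Type := {s : Surface g // s ∉ surfaceBoundary g}

/-- The middle point of the interval `[-1, 1]`. -/
def mid : Set.Icc (-1 : ℝ) 1 := ⟨0, by norm_num⟩

/-- A Seifert surface of genus `g` of a knot: an embedding of `Σ_{g,1}` in `S³` that maps the
boundary of `Σ_{g,1}` onto the knot, together with a bicollar `Σ_{g,1} × [-1, 1] → S³`. -/
structure SeifertSurface (K : Knot) (g : ℕ) where
  collar : C(Surface g × Set.Icc (-1 : ℝ) 1, Sphere3)
  injective : Function.Injective collar
  boundary_eq : (fun s => collar (s, mid)) '' surfaceBoundary g = K.carrier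

namespace SeifertSurface

variable {K : Knot} {g : ℕ} (F : SeifertSurface K g)

/-- The surface as a subset of `S³`. -/
def carrier : Set Sphere3 := Set.range fun s => F.collar (s, mid)

theorem knot_subset : K.carrier ⊆ F.carrier := by
  rw [← F.boundary_eq]
  rintro _ ⟨s, _, rfl⟩
  exact ⟨s, rfl⟩

/-- The complement `S³ \ F`. -/
abbrev Complement : Type := {x : Sphere3 // x ∉ F.carrier}

/-- The inclusion `S³ \ F → S³ \ K`. -/
def incl : C(F.Complement, K.Complement) where
  toFun x := ⟨x.1, fun h => x.2 (F.knot_subset h)⟩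
  continuous_toFun := by fun_prop

theorem collar_notMem {t : Set.Icc (-1 : ℝ) 1} (ht : t ≠ mid) (s : Surface g) :
    F.collar (s, t) ∉ F.carrier := by
  rintro ⟨s', h⟩
  exact ht (congrArg Prod.snd (F.injective h)).symm

theorem collar_notMem_knot (s : SurfaceInterior g) (t : Set.Icc (-1 : ℝ) 1) :
    F.collar (s.1, t) ∉ K.carrier := by
  rw [← F.boundary_eq]
  rintro ⟨s', hs', h⟩
  have h2 : s' = s.1 := congrArg Prod.fst (F.injective h)
  exact s.2 (h2 ▸ hs')

/-- The upper push-off `s ↦ s^♯` of the surface into `S³ \ F`. -/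
def sharp : C(SurfaceInterior g, F.Complement) where
  toFun s := ⟨F.collar (s.1, ⟨1, by norm_num⟩),
    F.collar_notMem (fun h => one_ne_zero (congrArg Subtype.val h)) s.1⟩
  continuous_toFun := by fun_prop

/-- The lower push-off `s ↦ s^♭` of the surface into `S³ \ F`. -/
def flat : C(SurfaceInterior g, F.Complement) where
  toFun s := ⟨F.collar (s.1, ⟨-1, by norm_num⟩),
    F.collar_notMem (fun h => neg_ne_zero.2 one_ne_zero (congrArg Subtype.val h)) s.1⟩
  continuous_toFun := by fun_prop

/-- The straight arc through the surface from `s^♯` to `s^♭`; it lies in `S³ \ K`. -/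
def crossing (s : SurfaceInterior g) : Path (F.incl (F.sharp s)) (F.incl (F.flat s)) where
  toFun t := ⟨F.collar (s.1, ⟨1 - 2 * (t : ℝ), by
    have h0 := t.2.1
    have h1 := t.2.2
    constructor <;> linarith⟩), F.collar_notMem_knot s _⟩
  continuous_toFun := by fun_prop
  source' := by simp [incl, sharp]
  target' := by
    apply Subtype.ext
    simp only [incl, flat, ContinuousMap.coe_mk]
    congr 2
    apply Subtype.ext
    norm_num

/-- The choices, besides the Seifert surface `F`, on which the presentation
`⟨x_1, …, x_{2g}, 𝔪 | 𝔪 y_j 𝔪⁻¹ = z_j⟩` of `π₁(S³ \ K, b)` depends: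
a free basis `u_1, …, u_{2g}` of `π₁(F)` (as provided by a spine of `F`), a free basis
`x_1, …, x_{2g}` of `π₁(S³ \ F)`, and paths that join the base points and form an arc crossing
`F` once, which closes up to the meridian `𝔪`. -/
structure Generators (b : K.Complement) where
  /-- the base point on the surface -/
  p : SurfaceInterior g
  u : Fin (2 * g) → Pi1 (SurfaceInterior g) p
  u_basis : Function.Bijective (FreeGroup.lift u)
  /-- the base point in the complement of the surface -/
  v : F.Complement
  x : Fin (2 * g) → Pi1 F.Complement v
  x_basis : Function.Bijective (FreeGroup.lift x)
  /-- the path to the base point of the knot group -/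
  α : Path b (F.incl v)
  βsharp : Path v (F.sharp p)
  βflat : Path v (F.flat p)
  isMeridian : K.IsMeridian (Pi1.transport α (Pi1.ofLoop
    (((βsharp.map F.incl.continuous).trans (F.crossing p)).trans
      (βflat.map F.incl.continuous).symm)))

namespace Generators

variable {F} {b : K.Complement} (D : F.Generators b)

/-- The meridian `𝔪`: it runs to the upper side of `F`, crosses `F` and returns from the lower
side. -/
def meridian : K.group b :=
  Pi1.transport D.α (Pi1.ofLoop
    (((D.βsharp.map F.incl.continuous).trans (F.crossing D.p)).trans
      (D.βflat.map F.incl.continuous).symm))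

/-- The generator `x_i` as an element of the knot group. -/
def gen (i : Fin (2 * g)) : K.group b := Pi1.transport D.α (Pi1.map F.incl D.v (D.x i))

/-- The isomorphism of the free group on `x_1, …, x_{2g}` with `π₁(S³ \ F)`. -/
def freeEquiv : FreeGroup (Fin (2 * g)) ≃* Pi1 F.Complement D.v :=
  MulEquiv.ofBijective (FreeGroup.lift D.x) D.x_basis

/-- The word `y_j` in `x_1, …, x_{2g}` that represents the lower push-off of `u_j`. -/
def y (j : Fin (2 * g)) : FreeGroup (Fin (2 * g)) :=
  D.freeEquiv.symm (Pi1.transport D.βflat (Pi1.map F.flat D.p (D.u j)))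

/-- The word `z_j` in `x_1, …, x_{2g}` that represents the upper push-off of `u_j`. -/
def z (j : Fin (2 * g)) : FreeGroup (Fin (2 * g)) :=
  D.freeEquiv.symm (Pi1.transport D.βsharp (Pi1.map F.sharp D.p (D.u j)))

variable {A : Type*} [Ring A] {κ : RingAut A}
  (ρ : MonoidAlgebra ℤ (K.group b) →+* Novikov κ)

/-- The standing assumption on a ring homomorphism `ρ : ℤ[π₁(S³ \ K)] → A_κ((τ))`:
`ρ(𝔪) = τ` and `ρ(x_i) ∈ A`. -/
structure Adapted : Prop where
  map_meridian : ρ (MonoidAlgebra.of ℤ _ D.meridian) = (Novikov.τ κ : Novikov κ)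
  map_gen : ∀ i, ∃ a : A, ρ (MonoidAlgebra.of ℤ _ (D.gen i)) = Novikov.C κ a

/-- `ρ` on the integral group ring of the free group on `x_1, …, x_{2g}`. -/
def wordMap : MonoidAlgebra ℤ (FreeGroup (Fin (2 * g))) →+* Novikov κ :=
  ρ.comp (MonoidAlgebra.mapDomainRingHom ℤ (FreeGroup.lift D.gen))

/-- The matrix with entries `τ ρ(∂y_j/∂x_i) - ρ(∂z_j/∂x_i)`, with row index `j` and column
index `i`. -/
def alexanderMatrix : Matrix (Fin (2 * g)) (Fin (2 * g)) (Novikov κ) :=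
  Matrix.of fun j i =>
    (Novikov.τ κ : Novikov κ) * D.wordMap ρ (fox i (D.y j)) - D.wordMap ρ (fox i (D.z j))

open Classical in
/-- The `K₁`-Alexander invariant: the class `τ^{-g} [A_{F,W}]` in `Q_{A,κ}` if the matrix is
invertible, and the neutral element otherwise. -/
def Δ : Q κ :=
  if h : IsUnit (D.alexanderMatrix ρ) then
    QuotientGroup.mk (K1.ofUnit (Novikov.τ κ) ^ (-(g : ℤ)) * K1.ofGL (2 * g) h.unit)
  else 1

/-- `τ^g Δ` in `Q_{A,κ}` (written multiplicatively). -/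
def τgΔ : Q κ := QuotientGroup.mk (K1.ofUnit (Novikov.τ κ) ^ g) * D.Δ ρ

end Generators

end SeifertSurface

end KnotLog

end

/-! Two facts combine: logarithm coefficients depend only on the class in `Q`, and the change of
indeterminate $T$ carries $\tau'^g\Delta_{\rho'}$ to $\tau^g\Delta_\rho$.

For the first, let $E=\tau\,d/d\tau$ be the Euler derivation. For $k>0$ the $\tau^k$-coefficient
with values in $\bar P_k$ is a trace on the whole Novikov ring (`coeffBar_mul_comm`), so
$M\mapsto\mathrm{tr}(M^{-1}E(M))$ in degree $k$ is a homomorphism on $GL_n$. It is stable and kills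
matrices over $A$, hence descends to `Q`. On a Witt vector it is $k$ times the logarithm coefficient
(`nsmul_logCoeff`), and division by $k$ is possible because $\mathbb Q\subseteq A$.

For the second, a path on $F$ between the two base points compares the choices (`exists_change`):
the free bases change by automorphisms $\theta,\psi$, the lower words are in addition conjugated by
some $a\in\pi_1(S^3\setminus F)$, and $\mathfrak m a=h\mathfrak m'h^{-1}$. Fox calculus gives
$B\,J(\theta)=J(\psi)\,A_{F,W}\,(1+uv)$ (`foxMatrix_change`), where $B$ is conjugate to the new
matrix, $u$ is the column $(x_i-1)(\tau-1)^{-1}\tau$ and $v$ is the row $\partial a/\partial x_i$.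
The Jacobians are invertible over $A$ and vanish in `Q`. By Sylvester's identity
(`ofGL_one_add_mul`), $[1+uv]=[1+vu]$, which is the class of the unit $(a\tau-1)(\tau-1)^{-1}$. All
meridians are conjugate (`Knot.IsMeridian.exists_conj`), so $a\tau$ is conjugate to $\tau$ and this
unit is a commutator: it contributes nothing. -/

noncomputable section

/-! ### The logarithmic derivative, and the logarithm on classes in `Q` -/

namespace KnotLog

namespace Novikov

variable {A : Type*} [Ring A] {κ : RingAut A}

/-! ### The trace property of the coefficients in `P̄_k` -/

theorem monomial_add (n : ℤ) (a b : A) :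
    monomial κ n (a + b) = monomial κ n a + monomial κ n b := by
  ext k; by_cases h : k = n <;> simp [coeff_monomial, h]

/-- The projection `a ↦ [a τ^n]` as a homomorphism. -/
def Pbar.mkHom (κ : RingAut A) (n : ℕ) : A →+ Pbar κ n :=
  AddMonoidHom.mk' (Pbar.mk κ n) fun a b => by
    rw [Pbar.mk, Pbar.mk, Pbar.mk, ← QuotientAddGroup.mk_add]
    congr 1
    exact Subtype.ext (monomial_add _ _ _)

theorem Pbar.mkHom_apply (n : ℕ) (a : A) : Pbar.mkHom κ n a = Pbar.mk κ n a := rfl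

theorem Pbar.mk_surjective (n : ℕ) : Function.Surjective (Pbar.mk κ n) := by
  intro x
  obtain ⟨⟨_, a, rfl⟩, rfl⟩ := QuotientAddGroup.mk_surjective x
  exact ⟨a, rfl⟩

theorem Pbar.mk_eq_mk_iff {n : ℕ} {a b : A} :
    Pbar.mk κ n a = Pbar.mk κ n b ↔ monomial κ n (a - b) ∈ P' κ n := by
  rw [← Pbar.mkHom_apply, ← Pbar.mkHom_apply, ← sub_eq_zero, ← map_sub]
  exact (QuotientAddGroup.eq_zero_iff _).trans AddSubgroup.mem_addSubgroupOf

theorem Pbar.mk_mul_comm_nat {i j n : ℕ} (h : i + j = n) (a b : A) :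
    Pbar.mk κ n (a * (κ ^ (i : ℤ)) b) = Pbar.mk κ n (b * (κ ^ (j : ℤ)) a) := by
  rw [Pbar.mk_eq_mk_iff]
  refine AddSubgroup.subset_closure ⟨i, j, h, monomial κ i a, ⟨a, rfl⟩, monomial κ j b, ⟨b, rfl⟩, ?_⟩
  rw [monomial_mul_monomial, monomial_mul_monomial, add_comm (j : ℤ), ← Nat.cast_add, h,
    eq_sub_iff_add_eq, ← monomial_add, sub_add_cancel]

/-- The commutator of $\tau\in P_1$ with $a\tau^{n-1}\in P_{n-1}$ is $(\kappa(a)-a)\tau^n$. This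
needs $n\ge1$, and is the reason why degree $0$ is excluded below. -/
theorem Pbar.mk_zpow_apply {n : ℕ} (hn : 0 < n) (m : ℤ) (a : A) :
    Pbar.mk κ n ((κ ^ m) a) = Pbar.mk κ n a := by
  have step : ∀ a : A, Pbar.mk κ n (κ a) = Pbar.mk κ n a := fun a => by
    simpa using Pbar.mk_mul_comm_nat (κ := κ) (show 1 + (n - 1) = n by omega) 1 a
  induction m using Int.induction_on with
  | zero => simp
  | succ m ih => rw [add_comm, zpow_add, zpow_one, RingAut.mul_apply, step, ih]
  | pred m ih =>
    rw [← step, ← RingAut.mul_apply, ← zpow_one_add, show 1 + (-(m : ℤ) - 1) = -m by ring, ih]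

/-- $P'_n$ only contains commutators of elements of non-negative degree, while Laurent series also
produce negative $i$ or $j$. Applying $\kappa^i$, which is harmless in $\bar P_n$, reduces these to
a commutator of degrees $0$ and $n$. -/
theorem Pbar.mk_mul_comm {n : ℕ} (hn : 0 < n) {i j : ℤ} (h : i + j = n) (a b : A) :
    Pbar.mk κ n (a * (κ ^ i) b) = Pbar.mk κ n (b * (κ ^ j) a) := by
  rw [← Pbar.mk_zpow_apply hn i (b * _), map_mul, ← RingAut.mul_apply, ← zpow_add, h]
  simpa using Pbar.mk_mul_comm_nat (κ := κ) (zero_add n) a ((κ ^ i) b)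

/-- The coefficient of `τ^k` with values in `P̄_k`. -/
def coeffBar (κ : RingAut A) (k : ℕ) : Novikov κ →+ Pbar κ k :=
  (Pbar.mkHom κ k).comp (AddMonoidHom.mk' (fun f => f.coeff k) fun _ _ => rfl)

theorem coeffBar_apply (k : ℕ) (f : Novikov κ) : coeffBar κ k f = Pbar.mk κ k (f.coeff k) := rfl

theorem coeffBar_mul_comm {k : ℕ} (hk : 0 < k) (f g : Novikov κ) :
    coeffBar κ k (f * g) = coeffBar κ k (g * f) := by
  obtain ⟨N, hN⟩ := f.bdd
  obtain ⟨M, hM⟩ := g.bdd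
  rw [coeffBar_apply, coeffBar_apply, coeff_mul_eq_sum f g hN hM k _ subset_rfl,
    coeff_mul_eq_sum g f hM hN k _ subset_rfl, ← Pbar.mkHom_apply, ← Pbar.mkHom_apply,
    map_sum, map_sum]
  refine Finset.sum_nbij' (fun i => k - i) (fun i => k - i) ?_ ?_ ?_ ?_ ?_
  · intro i; simp only [Finset.mem_Icc]; omega
  · intro i; simp only [Finset.mem_Icc]; omega
  · intro i _; simp
  · intro i _; simp
  · intro i _
    rw [Pbar.mkHom_apply, Pbar.mkHom_apply, Pbar.mk_mul_comm hk (add_sub_cancel i (k : ℤ)),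
      sub_sub_cancel]

/-- The matrix trace inherits cyclicity from the trace property of the coefficient, although the
ring is not commutative. -/
theorem coeffBar_trace_mul_comm {ι : Type*} [Fintype ι] {k : ℕ} (hk : 0 < k)
    (X Y : Matrix ι ι (Novikov κ)) :
    coeffBar κ k (X * Y).trace = coeffBar κ k (Y * X).trace := by
  simp only [Matrix.trace, Matrix.diag, Matrix.mul_apply, map_sum]
  rw [Finset.sum_comm]
  exact Finset.sum_congr rfl fun i _ => Finset.sum_congr rfl fun j _ => coeffBar_mul_comm hk _ _

/-! ### The Euler derivation and the logarithmic derivative -/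

/-- The derivation `∑ a_n τ^n ↦ ∑ n a_n τ^n`. -/
def euler (κ : RingAut A) : Novikov κ →+ Novikov κ :=
  AddMonoidHom.mk' (fun f => mk κ (fun n => n • f.coeff n) (by
    obtain ⟨N, hN⟩ := f.bdd
    exact ⟨N, fun n hn => by simp [hN n hn]⟩)) fun f g => by ext n; simp

@[simp] theorem coeff_euler (f : Novikov κ) (n : ℤ) : (euler κ f).coeff n = n • f.coeff n := rfl

theorem euler_mul (f g : Novikov κ) : euler κ (f * g) = euler κ f * g + f * euler κ g := by
  obtain ⟨N, hN⟩ := f.bdd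
  obtain ⟨M, hM⟩ := g.bdd
  ext n
  rw [coeff_euler, coeff_add, coeff_mul_eq_sum f g hN hM n _ subset_rfl,
    coeff_mul_eq_sum (euler κ f) g (fun m hm => by simp [hN m hm]) hM n _ subset_rfl,
    coeff_mul_eq_sum f (euler κ g) hN (fun m hm => by simp [hM m hm]) n _ subset_rfl,
    Finset.smul_sum, ← Finset.sum_add_distrib]
  refine Finset.sum_congr rfl fun i _ => ?_
  rw [coeff_euler, coeff_euler, map_zsmul, smul_mul_assoc, mul_smul_comm, ← add_smul,
    add_sub_cancel]

theorem euler_one : euler κ 1 = 0 := by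
  ext n; by_cases h : n = 0 <;> simp [one_def, coeff_monomial, h]

theorem euler_C (a : A) : euler κ (C κ a) = 0 := by
  ext n; by_cases h : n = 0 <;> simp [C, coeff_monomial, h]

theorem euler_map_mul {ι : Type*} [Fintype ι] (X Y : Matrix ι ι (Novikov κ)) :
    (X * Y).map (euler κ) = X.map (euler κ) * Y + X * Y.map (euler κ) := by
  ext1 i j
  simp only [Matrix.map_apply, Matrix.mul_apply, Matrix.add_apply, map_sum, euler_mul,
    Finset.sum_add_distrib]

/-- The logarithmic derivative `M ↦ tr (M⁻¹ · τ dM/dτ)` in degree `k`. -/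
def dlogGL (κ : RingAut A) {k : ℕ} (hk : 0 < k) (n : ℕ) :
    GLn (Novikov κ) n →* Multiplicative (Pbar κ k) :=
  MonoidHom.mk' (fun M => Multiplicative.ofAdd (coeffBar κ k
    (M⁻¹.val * M.val.map (euler κ)).trace)) fun M N => by
      -- $(MN)^{-1}E(MN)=N^{-1}(M^{-1}E(M))N+N^{-1}E(N)$, and cyclicity removes the conjugation by
      -- $N$.
      rw [← ofAdd_add, Units.val_mul, euler_map_mul, mul_add, Matrix.trace_add,
        map_add, mul_inv_rev, Units.val_mul]
      congr 2
      · rw [← mul_assoc, coeffBar_trace_mul_comm hk, mul_assoc, ← mul_assoc, ← mul_assoc]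
        simp
      · rw [mul_assoc, ← mul_assoc _ M.val]
        simp

/-- The entries added by stabilization are $0$ or $1$, and `d` kills both, so only the corner
contributes. With $X=M^{-1}$ and $Y=M$ this is the compatibility of `dlogGL` with stabilization. -/
theorem trace_stabMatrix_mul_map {R : Type*} [Ring R] {m n : ℕ} (h : m ≤ n) (d : R →+ R)
    (hd : d 1 = 0) (X Y : Matrix (Fin m) (Fin m) R) :
    (stabMatrix n X * (stabMatrix n Y).map d).trace = (X * Y.map d).trace := by
  have key : ∀ i k : Fin n, stabMatrix n X i k * d (stabMatrix n Y k i) =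
      if hik : (i : ℕ) < m ∧ (k : ℕ) < m then X ⟨i, hik.1⟩ ⟨k, hik.2⟩ *
        d (Y ⟨k, hik.2⟩ ⟨i, hik.1⟩) else 0 := by
    intro i k
    by_cases hik : (i : ℕ) < m ∧ (k : ℕ) < m
    · simp [stabMatrix, hik]
    · have : d (stabMatrix n Y k i) = 0 := by
        rw [stabMatrix, dif_neg (by tauto)]
        split_ifs <;> simp [hd]
      rw [this, mul_zero, dif_neg hik]
  simp only [Matrix.trace, Matrix.diag, Matrix.mul_apply, Matrix.map_apply, key]
  symm
  rw [← Finset.sum_subset (Finset.subset_univ (Finset.univ.map (Fin.castLEEmb h))), Finset.sum_map]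
  · refine Finset.sum_congr rfl fun i _ => ?_
    rw [← Finset.sum_subset (Finset.subset_univ (Finset.univ.map (Fin.castLEEmb h))),
      Finset.sum_map]
    · simp
    · intro k _ hk
      refine dif_neg fun hik => hk ?_
      rw [Finset.mem_map]
      exact ⟨⟨k, hik.2⟩, Finset.mem_univ _, rfl⟩
  · intro k _ hk
    refine Finset.sum_eq_zero fun i _ => dif_neg fun hik => hk ?_
    rw [Finset.mem_map]
    exact ⟨⟨k, hik.1⟩, Finset.mem_univ _, rfl⟩

/-- The logarithmic derivative on `K₁`. -/
def dlogK1 (κ : RingAut A) {k : ℕ} (hk : 0 < k) :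
    K1 (Novikov κ) →* Multiplicative (Pbar κ k) :=
  Abelianization.lift
    { toFun := DirectLimit.lift _ (fun n => dlogGL κ hk n) fun m n h M =>
        congrArg (fun x => Multiplicative.ofAdd (coeffBar κ k x))
          (trace_stabMatrix_mul_map h (euler κ) euler_one M⁻¹.val M.val).symm
      map_one' := by
        rw [DirectLimit.one_def 0]
        exact map_one (dlogGL κ hk 0)
      map_mul' := DirectLimit.induction₂ _ fun n M N => by
        rw [DirectLimit.mul_def]
        exact map_mul (dlogGL κ hk n) M N }

theorem dlogK1_ofUnit {k : ℕ} (hk : 0 < k) (u : (Novikov κ)ˣ) :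
    dlogK1 κ hk (K1.ofUnit u) = Multiplicative.ofAdd (coeffBar κ k (u⁻¹.val * euler κ u.val)) := by
  change Multiplicative.ofAdd (coeffBar κ k (Matrix.trace _)) = _
  rw [Matrix.trace_fin_one, Matrix.mul_apply, Fin.sum_univ_one]
  rfl

theorem K1_induction {R : Type*} [Ring R] {p : K1 R → Prop}
    (h : ∀ n (M : GLn R n), p (K1.ofGL n M)) (x : K1 R) : p x := by
  obtain ⟨y, rfl⟩ := QuotientGroup.mk_surjective x
  induction y using DirectLimit.induction with
  | _ n M => exact h n M

theorem dlogK1_map_C {k : ℕ} (hk : 0 < k) (x : K1 A) : dlogK1 κ hk (K1.map (C κ) x) = 1 := by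
  induction x using K1_induction with
  | _ n M =>
    change Multiplicative.ofAdd (coeffBar κ k (Matrix.trace _)) = _
    have : (K1.mapGL (C κ) n M).val.map (euler κ) = 0 := by
      ext1 i j
      exact euler_C _
    rw [this, mul_zero, Matrix.trace_zero, map_zero, ofAdd_zero]

/-- The logarithmic derivative on `Q_{A,κ}`. -/
def dlogQ (κ : RingAut A) {k : ℕ} (hk : 0 < k) : Q κ →* Multiplicative (Pbar κ k) :=
  QuotientGroup.lift _ (dlogK1 κ hk) fun _ hx => by
    obtain ⟨y, rfl⟩ := hx
    exact dlogK1_map_C hk y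

theorem dlogQ_mk {k : ℕ} (hk : 0 < k) (x : K1 (Novikov κ)) :
    dlogQ κ hk (QuotientGroup.mk x) = dlogK1 κ hk x := rfl

/-! ### Comparison with the logarithm -/

theorem coeff_pow_eq_zero {x : Novikov κ} (hx : ∀ n < 1, x.coeff n = 0) (r : ℕ) :
    ∀ n < (r : ℤ), (x ^ r).coeff n = 0 := by
  induction r with
  | zero => intro n hn; rw [pow_zero, one_def, coeff_monomial, if_neg (by simpa using hn.ne)]
  | succ r ih =>
    intro n hn
    rw [pow_succ]
    exact mul_bdd ih hx n (by simpa using hn)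

/-- By the Leibniz rule $E(x^{r+1})$ is the sum of the $r+1$ terms $x^iE(x)x^{r-i}$, which become
equal under the trace. The extra factor $x^s$ collects the powers that the induction splits off. -/
theorem coeffBar_euler_pow_mul_pow {k : ℕ} (hk : 0 < k) (x : Novikov κ) (r s : ℕ) :
    coeffBar κ k (euler κ (x ^ (r + 1)) * x ^ s) =
      (r + 1) • coeffBar κ k (x ^ (r + s) * euler κ x) := by
  induction r generalizing s with
  | zero => simp [coeffBar_mul_comm hk]
  | succ r ih =>
    rw [pow_succ x (r + 1), euler_mul, add_mul, map_add, mul_assoc, ← pow_succ', ih,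
      coeffBar_mul_comm hk _ (x ^ s), ← mul_assoc, ← pow_add, succ_nsmul _ (r + 1),
      show r + (s + 1) = r + 1 + s by ring, add_comm s]

theorem coeffBar_euler_pow {k : ℕ} (hk : 0 < k) (x : Novikov κ) (r : ℕ) :
    coeffBar κ k (euler κ (x ^ (r + 1))) = (r + 1) • coeffBar κ k (x ^ r * euler κ x) := by
  simpa using coeffBar_euler_pow_mul_pow hk x r 0

theorem witt_sub_one_coeff (w : witt κ) :
    ∀ n < 1, (((w.1 : powerSeries κ) : Novikov κ) - 1).coeff n = 0 := by
  intro n hn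
  rcases lt_or_eq_of_le (show n ≤ 0 by omega) with h | rfl
  · rw [coeff_sub, (w.1 : powerSeries κ).2 n h, one_def, coeff_monomial, if_neg h.ne, sub_zero]
  · have h := w.2
    change (w.1 : powerSeries κ).1.coeff 0 = 1 at h
    rw [coeff_sub, h, one_def, coeff_monomial, if_pos rfl, sub_self]

/-- A Witt vector as a unit of the Novikov ring. -/
def wittUnit (κ : RingAut A) : witt κ →* (Novikov κ)ˣ :=
  (Units.map (powerSeries κ).subtype.toMonoidHom).comp (witt κ).subtype

theorem toQ_wittToK1 (w : witt κ) :
    toQ κ (wittToK1 κ w) = QuotientGroup.mk (K1.ofUnit (wittUnit κ w)) := by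
  change QuotientGroup.mk (K1.ofGL 1 _) = QuotientGroup.mk (K1.ofGL 1 _)
  congr 2
  ext i j
  simp [K1.mapGL, wittUnit, Matrix.diagonal_apply]
  split_ifs <;> rfl

section Log

variable [Algebra ℚ A]

/-- Rational constants are central in `A`, and every automorphism of `A` fixes them, so they also
commute with $\tau$. Hence $P'_n$ is stable under rational multiples. -/
theorem C_rat_commute (q : ℚ) (y : Novikov κ) : Commute (C κ (algebraMap ℚ A q)) y := by
  ext n
  change (monomial κ 0 _ * y).coeff n = (y * monomial κ 0 _).coeff n
  rw [coeff_monomial_mul, coeff_mul_monomial]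
  have : (κ ^ (n - 0)) (algebraMap ℚ A q) = algebraMap ℚ A q :=
    RingHom.map_rat_algebraMap ((κ ^ (n - 0) : RingAut A) : A →+* A) q
  rw [this]
  simpa using Algebra.commutes q (y.coeff n)

theorem C_rat_mul_mem_P {n : ℕ} {x : Novikov κ} (hx : x ∈ P κ n) (q : ℚ) :
    C κ (algebraMap ℚ A q) * x ∈ P κ n := by
  obtain ⟨a, rfl⟩ := hx
  exact ⟨algebraMap ℚ A q * a, by simp [C, monomial_mul_monomial]⟩

theorem C_rat_mul_mem_P' {n : ℕ} {x : Novikov κ} (hx : x ∈ P' κ n) (q : ℚ) :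
    C κ (algebraMap ℚ A q) * x ∈ P' κ n := by
  induction hx using AddSubgroup.closure_induction with
  | mem x hx =>
    obtain ⟨i, j, hij, y, hy, z, hz, rfl⟩ := hx
    refine AddSubgroup.subset_closure ⟨i, j, hij, _, C_rat_mul_mem_P hy q, z, hz, ?_⟩
    rw [mul_sub, ← mul_assoc, ← mul_assoc, (C_rat_commute q z).eq, mul_assoc z]
  | zero => rw [mul_zero]; exact zero_mem _
  | add x y _ _ hx hy => rw [mul_add]; exact add_mem hx hy
  | neg x _ hx => rw [mul_neg]; exact neg_mem hx

theorem Pbar.mk_smul_congr {n : ℕ} {a b : A} (h : Pbar.mk κ n a = Pbar.mk κ n b) (q : ℚ) :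
    Pbar.mk κ n (q • a) = Pbar.mk κ n (q • b) := by
  rw [Pbar.mk_eq_mk_iff] at h ⊢
  have := C_rat_mul_mem_P' h q
  simpa [C, monomial_mul_monomial, ← Algebra.smul_def, smul_sub] using this

/-- Multiplication by $1/k$ is well defined modulo $P'_n$ by `Pbar.mk_smul_congr`, so $\bar P_n$ has
no torsion. -/
theorem Pbar.nsmul_injective {n k : ℕ} (hk : 0 < k) :
    Function.Injective fun x : Pbar κ n => k • x := by
  intro x y h
  obtain ⟨a, rfl⟩ := Pbar.mk_surjective n x
  obtain ⟨b, rfl⟩ := Pbar.mk_surjective n y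
  simp only [← Pbar.mkHom_apply, ← map_nsmul] at h
  have := Pbar.mk_smul_congr (κ := κ) h (k : ℚ)⁻¹
  have hk' : (k : ℚ) ≠ 0 := by positivity
  simpa [← Nat.cast_smul_eq_nsmul ℚ, smul_smul, hk'] using this

/-- This is $E(\log u)=u^{-1}E(u)$ under the trace, for $u=1+x$: multiplication by $k$ is $E$ in
degree $k$, and $E(x^r)/r$ becomes $x^{r-1}E(x)$. Summation gives the geometric series for $u^{-1}$.
-/
theorem nsmul_logCoeff {k : ℕ} (hk : 0 < k) (w : witt κ) :
    k • logCoeff k w =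
      coeffBar κ k ((wittUnit κ w)⁻¹.val * euler κ (wittUnit κ w).val) := by
  set u := wittUnit κ w with hu
  set x : Novikov κ := u.val - 1 with hx
  have hx1 : ∀ n < 1, x.coeff n = 0 := witt_sub_one_coeff w
  have hxe : euler κ u.val = euler κ x := by rw [hx, map_sub, euler_one, sub_zero]
  -- The geometric series with an exact remainder, so that no infinite sum is needed.
  have hgeom : u⁻¹.val = ∑ r ∈ Finset.range k, (-x) ^ r + u⁻¹.val * (-x) ^ k := by
    have h1 : u.val * ∑ r ∈ Finset.range k, (-x) ^ r = 1 - (-x) ^ k := by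
      have := mul_neg_geom_sum (-x) k
      rwa [sub_neg_eq_add, hx, add_sub_cancel] at this
    rw [← u.mul_right_inj, mul_add, h1, ← mul_assoc, u.mul_inv, one_mul, sub_add_cancel]
  -- $(-x)^k$ starts in degree at least $k$ and $E(x)$ in degree at least $1$, so the remainder
  -- starts in degree at least $k+1$.
  have hrest : (u⁻¹.val * (-x) ^ k * euler κ x).coeff k = 0 := by
    have h0 : ∀ n < 0, (u⁻¹.val).coeff n = 0 := (w.1⁻¹.val).2
    have hnx : ∀ n < 1, (-x).coeff n = 0 := fun n hn => by simp [hx1 n hn]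
    refine mul_bdd (mul_bdd h0 (coeff_pow_eq_zero hnx k)) (M := 1)
      (fun n hn => by simp [hx1 n hn]) k (by omega)
  rw [hxe, hgeom, add_mul, map_add, coeffBar_apply k (_ * _ * _), hrest, ← Pbar.mkHom_apply,
    map_zero, add_zero, Finset.sum_mul, map_sum, logCoeff, ← Pbar.mkHom_apply, map_sum,
    Finset.smul_sum]
  refine Finset.sum_nbij' (fun r => r - 1) (fun r => r + 1) ?_ ?_ ?_ ?_ ?_
  · intro r; simp only [Finset.mem_Icc, Finset.mem_range]; omega
  · intro r; simp only [Finset.mem_Icc, Finset.mem_range]; omega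
  · intro r; simp only [Finset.mem_Icc]; omega
  · intro r _; simp
  · intro r hr
    obtain ⟨r, rfl⟩ : ∃ m, r = m + 1 := ⟨r - 1, by rw [Finset.mem_Icc] at hr; omega⟩
    rw [Nat.add_sub_cancel, coeffBar_apply, ← map_nsmul, Pbar.mkHom_apply]
    have h1 := coeffBar_euler_pow hk x r
    rw [coeffBar_apply, coeffBar_apply, ← Pbar.mkHom_apply k (Novikov.coeff (_ * _) _),
      ← map_nsmul, coeff_euler] at h1
    have h2 := Pbar.mk_smul_congr h1 ((-1) ^ r / ((r + 1 : ℕ) : ℚ))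
    have hr0 : ((r + 1 : ℕ) : ℚ) ≠ 0 := by positivity
    rw [natCast_zsmul, smul_comm, ← Nat.cast_smul_eq_nsmul ℚ (r + 1), smul_smul,
      div_mul_cancel₀ _ hr0] at h2
    refine h2.trans (congrArg _ ?_)
    rcases r.even_or_odd with he | ho
    · rw [he.neg_one_pow, he.neg_pow, one_smul]
    · rw [ho.neg_one_pow, ho.neg_pow, neg_smul, one_smul, neg_mul, coeff_neg]

/-- In positive degree the logarithmic derivative on `Q` determines $k$ times the coefficient, and
$k$ can be cancelled. In degree $0$ the defining sum is empty. -/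
theorem logCoeff_eq_of_toQ_eq {w v : witt κ}
    (h : toQ κ (wittToK1 κ w) = toQ κ (wittToK1 κ v)) (k : ℕ) : logCoeff k w = logCoeff k v := by
  rcases k.eq_zero_or_pos with rfl | hk
  · simp [logCoeff]
  · apply Pbar.nsmul_injective hk
    have h2 := congrArg (dlogQ κ hk) h
    rw [toQ_wittToK1, toQ_wittToK1] at h2
    rw [dlogQ_mk, dlogQ_mk, dlogK1_ofUnit, dlogK1_ofUnit] at h2
    simp only [nsmul_logCoeff hk]
    exact Multiplicative.ofAdd.injective h2

end Log
end Novikov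

end KnotLog

/-! ### Functoriality of $K_1$ and Sylvester's identity -/

namespace KnotLog

namespace K1

variable {R S T : Type*} [Ring R] [Ring S] [Ring T]

/-! ### Functoriality -/

theorem map_id' : K1.map (RingHom.id R) = MonoidHom.id _ := by
  refine MonoidHom.ext fun x => ?_
  induction x using Novikov.K1_induction with
  | _ n M => rfl

theorem map_map (f : R →+* S) (g : S →+* T) (x : K1 R) :
    K1.map g (K1.map f x) = K1.map (g.comp f) x := by
  induction x using Novikov.K1_induction with
  | _ n M => rfl

theorem map_ofUnit (f : R →+* S) (u : Rˣ) :
    K1.map f (ofUnit u) = ofUnit (Units.map f.toMonoidHom u) := by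
  refine congrArg (ofGL 1) (Units.ext ?_)
  ext i j
  simp [mapGL, Matrix.diagonal_apply]
  split_ifs <;> simp

theorem ofGL_stab {m n : ℕ} (h : m ≤ n) (M : GLn R m) : ofGL n (stab R h M) = ofGL m M :=
  congrArg Abelianization.of (DirectLimit.mk_apply (f := fun _ _ h => stab R h) m n M h)

/-! ### Invertible matrices with an arbitrary index type -/

section Index

variable {ι : Type*} [Fintype ι] [DecidableEq ι]

/-- The class in `K₁(R)` of an invertible matrix whose index type has been enumerated. -/
def ofMatrix {n : ℕ} (e : ι ≃ Fin n) : (Matrix ι ι R)ˣ →* K1 R :=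
  (ofGL n).comp (Units.map (Matrix.reindexRingEquiv R e).toRingHom.toMonoidHom)

/-- The invertible matrix of a permutation. -/
def permUnit (σ : Equiv.Perm ι) : (Matrix ι ι R)ˣ where
  val := (1 : Matrix ι ι R).submatrix σ id
  inv := (1 : Matrix ι ι R).submatrix id σ
  val_inv := by
    rw [← Matrix.submatrix_mul _ _ σ id σ Function.bijective_id]; simp
  inv_val := by
    rw [← Matrix.submatrix_mul _ _ id σ id σ.bijective]; simp

/-- Two enumerations differ by conjugation with a permutation matrix, which is invisible in an
abelian group. -/
theorem ofMatrix_eq {m n : ℕ} (e : ι ≃ Fin m) (e' : ι ≃ Fin n) (M : (Matrix ι ι R)ˣ) :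
    ofMatrix e M = ofMatrix e' M := by
  obtain rfl : m = n := by simpa using Fintype.card_congr (e.symm.trans e')
  have h : permUnit (e.symm.trans e') *
        Units.map (Matrix.reindexRingEquiv R e').toRingHom.toMonoidHom M =
      Units.map (Matrix.reindexRingEquiv R e).toRingHom.toMonoidHom M *
        permUnit (e.symm.trans e') := by
    apply Units.ext
    ext i j
    set σ := e.symm.trans e'
    have h1 := Matrix.one_submatrix_mul σ (Equiv.refl _) (Matrix.reindexRingEquiv R e' M.val)
    have h2 := Matrix.mul_submatrix_one σ id (Matrix.reindexRingEquiv R e M.val)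
    refine (congrFun₂ h1 i j).trans (Eq.trans ?_ (congrFun₂ h2 i j).symm)
    simp [σ, Matrix.reindexRingEquiv]
  have h2 := congrArg (ofGL (R := R) m) h
  rw [map_mul, map_mul, mul_comm] at h2
  exact (mul_right_cancel h2).symm

end Index

/-! ### Unipotent block matrices and Sylvester's identity -/

section Blocks

variable {m n : Type*} [Fintype m] [DecidableEq m] [Fintype n] [DecidableEq n]

/-- The matrix `(1, X; 0, 1)`. -/
def upperUnit (X : Matrix m n R) : (Matrix (m ⊕ n) (m ⊕ n) R)ˣ where
  val := Matrix.fromBlocks 1 X 0 1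
  inv := Matrix.fromBlocks 1 (-X) 0 1
  val_inv := by simp [Matrix.fromBlocks_multiply]
  inv_val := by simp [Matrix.fromBlocks_multiply]

/-- The matrix `(1, 0; X, 1)`. -/
def lowerUnit (X : Matrix n m R) : (Matrix (m ⊕ n) (m ⊕ n) R)ˣ where
  val := Matrix.fromBlocks 1 0 X 1
  inv := Matrix.fromBlocks 1 0 (-X) 1
  val_inv := by simp [Matrix.fromBlocks_multiply]
  inv_val := by simp [Matrix.fromBlocks_multiply]

/-- The block diagonal matrix `(M, 0; 0, N)`. -/
def diagUnit (M : (Matrix m m R)ˣ) (N : (Matrix n n R)ˣ) : (Matrix (m ⊕ n) (m ⊕ n) R)ˣ where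
  val := Matrix.fromBlocks M.val 0 0 N.val
  inv := Matrix.fromBlocks M⁻¹.val 0 0 N⁻¹.val
  val_inv := by simp [Matrix.fromBlocks_multiply]
  inv_val := by simp [Matrix.fromBlocks_multiply]

variable {G : Type*} [CommGroup G] (f : (Matrix (m ⊕ n) (m ⊕ n) R)ˣ →* G)

/-- Conjugation by $\mathrm{diag}(2,1)$ turns the matrix into its square, so its image in an abelian
group equals its own square. Since $2$ is invertible, no stabilization is required. -/
theorem map_upperUnit (h2 : IsUnit (2 : R)) (X : Matrix m n R) : f (upperUnit X) = 1 := by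
  obtain ⟨z, hz⟩ := h2
  let d : (Matrix (m ⊕ n) (m ⊕ n) R)ˣ :=
    diagUnit (Units.map (Matrix.scalar m).toMonoidHom z) 1
  have h : d * upperUnit X = upperUnit X * upperUnit X * d := by
    apply Units.ext
    simp [d, diagUnit, upperUnit, Matrix.fromBlocks_multiply, hz]
    ext i j
    simp [Matrix.diagonal_mul, two_mul]
  have := congrArg f h
  rw [map_mul, map_mul, map_mul, mul_comm] at this
  simpa using mul_right_cancel this

theorem map_lowerUnit (h2 : IsUnit (2 : R)) (X : Matrix n m R) : f (lowerUnit X) = 1 := by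
  obtain ⟨z, hz⟩ := h2
  let d : (Matrix (m ⊕ n) (m ⊕ n) R)ˣ :=
    diagUnit 1 (Units.map (Matrix.scalar n).toMonoidHom z)
  have h : d * lowerUnit X = lowerUnit X * lowerUnit X * d := by
    apply Units.ext
    simp [d, diagUnit, lowerUnit, Matrix.fromBlocks_multiply, hz]
    ext i j
    simp [Matrix.diagonal_mul, two_mul]
  have := congrArg f h
  rw [map_mul, map_mul, map_mul, mul_comm] at this
  simpa using mul_right_cancel this

/-- Both block matrices are brought to $\begin{pmatrix}1&-u\\v&1\end{pmatrix}$ by unipotent factors,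
which `f` kills. -/
theorem map_diagUnit_one_add_mul (h2 : IsUnit (2 : R)) (u : Matrix m n R) (v : Matrix n m R)
    (M : (Matrix m m R)ˣ) (N : (Matrix n n R)ˣ) (hM : M.val = 1 + u * v) (hN : N.val = 1 + v * u) :
    f (diagUnit M 1) = f (diagUnit 1 N) := by
  have h : upperUnit (-u) * diagUnit M 1 * lowerUnit v =
      lowerUnit v * diagUnit 1 N * upperUnit (-u) := by
    apply Units.ext
    simp [diagUnit, upperUnit, lowerUnit, Matrix.fromBlocks_multiply, hM, hN]
  have := congrArg f h
  simpa [map_upperUnit f h2, map_lowerUnit f h2] using this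

end Blocks

theorem ofGL_one_add_mul (h2 : IsUnit (2 : R)) {m n : ℕ} (u : Matrix (Fin m) (Fin n) R)
    (v : Matrix (Fin n) (Fin m) R) (M : GLn R m) (N : GLn R n) (hM : M.val = 1 + u * v)
    (hN : N.val = 1 + v * u) : ofGL m M = ofGL n N := by
  have h := map_diagUnit_one_add_mul (ofMatrix finSumFinEquiv) h2 u v M N hM hN
  -- The blocks are enumerated in the opposite order so that $N$ sits in the upper left corner,
  -- where stabilization puts it.
  rw [ofMatrix_eq finSumFinEquiv ((Equiv.sumComm _ _).trans finSumFinEquiv) (diagUnit 1 N)] at h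
  rw [← ofGL_stab (Nat.le_add_right m n) M, ← ofGL_stab (Nat.le_add_right n m) N]
  convert h using 1
  · refine congrArg (ofGL (m + n)) (Units.ext ?_)
    ext i j
    refine Fin.addCases (fun i => ?_) (fun i => ?_) i <;>
      refine Fin.addCases (fun j => ?_) (fun j => ?_) j <;>
      simp [stab_apply, stabMatrix, diagUnit, Matrix.reindexRingEquiv]
    all_goals first
      | (simp [Matrix.one_apply])
      | (intro h; have := i.2; have := j.2; simp [Fin.ext_iff] at h; omega)
  · refine congrArg (ofGL (n + m)) (Units.ext ?_)
    ext i j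
    refine Fin.addCases (fun i => ?_) (fun i => ?_) i <;>
      refine Fin.addCases (fun j => ?_) (fun j => ?_) j <;>
      simp [stab_apply, stabMatrix, diagUnit, Matrix.reindexRingEquiv]
    all_goals first
      | (simp [Matrix.one_apply])
      | (intro h; have := i.2; have := j.2; simp [Fin.ext_iff] at h; omega)

/-- The inverse is $1-u(1+vu)^{-1}v$. -/
theorem isUnit_one_add_mul {m n : Type*} [Fintype m] [DecidableEq m] [Fintype n] [DecidableEq n]
    (u : Matrix m n R) (v : Matrix n m R) (h : IsUnit (1 + v * u)) : IsUnit (1 + u * v) := by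
  obtain ⟨N, hN⟩ := h
  have e1 : v * u = N.val - 1 := by rw [hN]; abel
  refine ⟨⟨1 + u * v, 1 - u * N⁻¹.val * v, ?_, ?_⟩, rfl⟩
  · have : u * v * (u * N⁻¹.val * v) = u * (v * u) * N⁻¹.val * v := by
      simp only [Matrix.mul_assoc]
    rw [add_mul, one_mul, mul_sub, mul_one, this, e1, Matrix.mul_sub, Matrix.mul_one,
      Matrix.sub_mul, Matrix.mul_assoc u]
    rw [Matrix.mul_assoc u N.val, Units.mul_inv, Matrix.mul_one, Matrix.sub_mul, Matrix.mul_assoc]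
    abel
  · have : u * N⁻¹.val * v * (u * v) = u * (N⁻¹.val * (v * u)) * v := by
      simp only [Matrix.mul_assoc]
    rw [sub_mul, one_mul, mul_add, mul_one, this, e1, mul_sub, mul_one, Units.inv_mul,
      Matrix.mul_sub, Matrix.mul_one, Matrix.sub_mul]
    abel

end K1

end KnotLog

/-! ### Fox calculus and the change of generators in a Fox matrix -/

namespace KnotLog

/-! ### Fox calculus -/

section Fox

variable {ι ι' ι'' : Type*} {R S : Type*} [Ring R] [Ring S]

/-- The ring homomorphism of integral group rings induced by a group homomorphism. -/
abbrev groupRingMap {G H : Type*} [Group G] [Group H] (θ : G →* H) :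
    MonoidAlgebra ℤ G →+* MonoidAlgebra ℤ H := MonoidAlgebra.mapDomainRingHom ℤ θ

theorem groupRingMap_of {G H : Type*} [Group G] [Group H] (θ : G →* H) (g : G) :
    groupRingMap θ (MonoidAlgebra.of ℤ G g) = MonoidAlgebra.of ℤ H (θ g) := by
  simp

theorem groupRing_hom_ext {G : Type*} [Group G] {f g : MonoidAlgebra ℤ G →+* R}
    (h : ∀ x, f (MonoidAlgebra.of ℤ G x) = g (MonoidAlgebra.of ℤ G x)) : f = g :=
  MonoidAlgebra.ringHom_ext (fun r => by
    have : (MonoidAlgebra.single 1 r : MonoidAlgebra ℤ G) = (r : MonoidAlgebra ℤ G) := by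
      simp [MonoidAlgebra.intCast_def]
    rw [this, map_intCast, map_intCast]) h

/-- A crossed homomorphism on a free group is determined by its Fox expansion. -/
theorem crossedHom_eq_sum_fox [Fintype ι] [DecidableEq ι]
    (Λ : MonoidAlgebra ℤ (FreeGroup ι) →+* R) (d : FreeGroup ι → R)
    (hd : ∀ h k, d (h * k) = d h + Λ (MonoidAlgebra.of ℤ _ h) * d k) (h : FreeGroup ι) :
    d h = ∑ i, Λ (fox i h) * d (FreeGroup.of i) := by
  have d1 : d 1 = 0 := by
    have := hd 1 1
    rwa [mul_one, map_one, map_one, one_mul, left_eq_add] at this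
  have f1 : ∀ i : ι, fox i 1 = 0 := fun i => by
    have := fox_mul i 1 1
    rwa [mul_one, map_one, one_mul, left_eq_add] at this
  induction h using FreeGroup.induction_on with
  | C1 => simp [d1, f1]
  | of j => simp [fox_of]
  | inv_of j _ =>
    have e1 : d (FreeGroup.of j)⁻¹ =
        -(Λ (MonoidAlgebra.of ℤ _ (FreeGroup.of j)⁻¹) * d (FreeGroup.of j)) := by
      have := hd (FreeGroup.of j)⁻¹ (FreeGroup.of j)
      rw [inv_mul_cancel, d1] at this
      exact eq_neg_of_add_eq_zero_left this.symm
    have e2 : ∀ i, fox i (FreeGroup.of j)⁻¹ =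
        -(MonoidAlgebra.of ℤ _ (FreeGroup.of j)⁻¹ * if j = i then 1 else 0) := fun i => by
      have := fox_mul i (FreeGroup.of j)⁻¹ (FreeGroup.of j)
      rw [inv_mul_cancel, f1, fox_of] at this
      exact eq_neg_of_add_eq_zero_left this.symm
    rw [Finset.sum_eq_single j]
    · rw [e1, e2, if_pos rfl, mul_one, map_neg, neg_mul]
    · intro i _ hi
      rw [e2, if_neg hi.symm, mul_zero, neg_zero, map_zero, zero_mul]
    · simp
  | mul x y hx hy =>
    rw [hd, hx, hy, Finset.mul_sum, ← Finset.sum_add_distrib]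
    refine Finset.sum_congr rfl fun i _ => ?_
    rw [fox_mul, map_add, map_mul, add_mul, mul_assoc]

/-- The map $h\mapsto\Lambda(h)-1$ is a crossed homomorphism. -/
theorem fox_fundamental_formula [Fintype ι] [DecidableEq ι]
    (Λ : MonoidAlgebra ℤ (FreeGroup ι) →+* R) (h : FreeGroup ι) :
    Λ (MonoidAlgebra.of ℤ _ h) - 1 =
      ∑ i, Λ (fox i h) * (Λ (MonoidAlgebra.of ℤ _ (FreeGroup.of i)) - 1) :=
  crossedHom_eq_sum_fox Λ (fun h => Λ (MonoidAlgebra.of ℤ _ h) - 1)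
    (fun h k => by rw [map_mul, map_mul]; noncomm_ring) h

/-- The map $h\mapsto\Lambda(\partial\theta(h)/\partial x_k)$ is a crossed homomorphism for the
coefficients $\Lambda\circ\theta$. -/
theorem fox_chain_rule [Fintype ι] [DecidableEq ι] [DecidableEq ι']
    (Λ : MonoidAlgebra ℤ (FreeGroup ι') →+* R)
    (θ : FreeGroup ι →* FreeGroup ι') (k : ι') (h : FreeGroup ι) :
    Λ (fox k (θ h)) =
      ∑ i, Λ (groupRingMap θ (fox i h)) * Λ (fox k (θ (FreeGroup.of i))) :=
  crossedHom_eq_sum_fox (Λ.comp (groupRingMap θ)) (fun h => Λ (fox k (θ h)))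
    (fun h k => by
      rw [map_mul, fox_mul, map_add, map_mul, RingHom.comp_apply, groupRingMap_of]) h

/-- The Jacobian matrix of a homomorphism of free groups, with coefficients in `R`. -/
def jacobian [DecidableEq ι'] (Λ : MonoidAlgebra ℤ (FreeGroup ι') →+* R) (θ : FreeGroup ι →* FreeGroup ι') :
    Matrix ι ι' R := Matrix.of fun i k => Λ (fox k (θ (FreeGroup.of i)))

theorem jacobian_comp [Fintype ι'] [DecidableEq ι'] [DecidableEq ι'']
    (Λ : MonoidAlgebra ℤ (FreeGroup ι'') →+* R)
    (θ : FreeGroup ι' →* FreeGroup ι'') (φ : FreeGroup ι →* FreeGroup ι') :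
    jacobian (Λ.comp (groupRingMap θ)) φ * jacobian Λ θ = jacobian Λ (θ.comp φ) := by
  ext i k
  exact (fox_chain_rule Λ θ k (φ (FreeGroup.of i))).symm

theorem jacobian_id [DecidableEq ι] (Λ : MonoidAlgebra ℤ (FreeGroup ι) →+* R) :
    jacobian Λ (MonoidHom.id _) = 1 := by
  ext i k
  rw [jacobian, Matrix.of_apply, MonoidHom.id_apply, fox_of, Matrix.one_apply]
  split_ifs <;> simp

/-- The Jacobian of an automorphism of a free group, as an invertible matrix. -/
def jacobianUnit [Fintype ι] [DecidableEq ι] (Λ : MonoidAlgebra ℤ (FreeGroup ι) →+* R) (θ : FreeGroup ι ≃* FreeGroup ι) :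
    (Matrix ι ι R)ˣ where
  val := jacobian Λ θ.toMonoidHom
  inv := jacobian (Λ.comp (groupRingMap θ.toMonoidHom)) θ.symm.toMonoidHom
  val_inv := by
    have h := jacobian_comp (Λ.comp (groupRingMap θ.toMonoidHom)) θ.symm.toMonoidHom
      θ.toMonoidHom
    have e : (Λ.comp (groupRingMap θ.toMonoidHom)).comp (groupRingMap θ.symm.toMonoidHom) = Λ :=
      groupRing_hom_ext fun x => by simp
    have e2 : θ.symm.toMonoidHom.comp θ.toMonoidHom = MonoidHom.id _ :=
      MonoidHom.ext fun x => by simp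
    rwa [e, e2, jacobian_id] at h
  inv_val := by
    rw [jacobian_comp]
    have e2 : θ.toMonoidHom.comp θ.symm.toMonoidHom = MonoidHom.id _ :=
      MonoidHom.ext fun x => by simp
    rw [e2, jacobian_id]

theorem mapGL_jacobianUnit {m : ℕ} (f : R →+* S)
    (Λ : MonoidAlgebra ℤ (FreeGroup (Fin m)) →+* R) (θ : FreeGroup (Fin m) ≃* FreeGroup (Fin m)) :
    K1.mapGL f m (jacobianUnit Λ θ) = jacobianUnit (f.comp Λ) θ :=
  Units.ext rfl

end Fox

/-! ### The Fox matrix of an HNN presentation under a change of generators -/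

section FoxMatrix

variable {ι : Type*} {R : Type*} [Ring R]

/-- Conjugation by the unit $t$ is a ring homomorphism, so the relation only has to be checked on
generators. -/
theorem intertwine_of_basis (Λ : MonoidAlgebra ℤ (FreeGroup ι) →+* R)
    {t : R} {y z : ι → FreeGroup ι} (ht : IsUnit t)
    (h : ∀ j, t * Λ (MonoidAlgebra.of ℤ _ (y j)) = Λ (MonoidAlgebra.of ℤ _ (z j)) * t)
    (ξ : MonoidAlgebra ℤ (FreeGroup ι)) :
    t * Λ (groupRingMap (FreeGroup.lift y) ξ) = Λ (groupRingMap (FreeGroup.lift z) ξ) * t := by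
  obtain ⟨t, rfl⟩ := ht
  let c : R →+* R := (MulSemiringAction.toRingHom (ConjAct Rˣ) R (ConjAct.toConjAct t))
  have hc : ∀ r, c r = t * r * (t⁻¹ : Rˣ) := fun r => rfl
  have key : (c.comp Λ).comp (groupRingMap (FreeGroup.lift y)) =
      Λ.comp (groupRingMap (FreeGroup.lift z)) := by
    refine groupRing_hom_ext fun x => ?_
    have : ((c.comp Λ).comp (groupRingMap (FreeGroup.lift y))).toMonoidHom.comp
        (MonoidAlgebra.of ℤ _) = (Λ.comp (groupRingMap (FreeGroup.lift z))).toMonoidHom.comp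
        (MonoidAlgebra.of ℤ _) := by
      refine FreeGroup.ext_hom _ _ fun j => ?_
      change c (Λ (groupRingMap _ (MonoidAlgebra.of ℤ _ (FreeGroup.of j)))) =
        Λ (groupRingMap _ (MonoidAlgebra.of ℤ _ (FreeGroup.of j)))
      rw [groupRingMap_of, groupRingMap_of, FreeGroup.lift_apply_of, FreeGroup.lift_apply_of, hc,
        h, mul_assoc, t.mul_inv, mul_one]
    exact DFunLike.congr_fun this x
  have h2 := DFunLike.congr_fun key ξ
  simp only [RingHom.comp_apply, hc] at h2
  rw [← h2, mul_assoc _ _ (t : R), t.inv_mul, mul_one]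

variable [Fintype ι] [DecidableEq ι]

/-- The matrix with entries `t ∂y_j/∂x_i - ∂z_j/∂x_i`. -/
def foxMatrix (Λ : MonoidAlgebra ℤ (FreeGroup ι) →+* R) (t : R) (y z : ι → FreeGroup ι) :
    Matrix ι ι R :=
  Matrix.of fun j i => t * Λ (fox i (y j)) - Λ (fox i (z j))

variable (Λ : MonoidAlgebra ℤ (FreeGroup ι) →+* R) (t : R) (y z : ι → FreeGroup ι)

/-- The column with entries `(x_i - 1) s`. -/
def augmentationColumn (s : R) : Matrix ι (Fin 1) R :=
  Matrix.of fun i _ => (Λ (MonoidAlgebra.of ℤ _ (FreeGroup.of i)) - 1) * s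

/-- The row of the Fox derivatives of a word. -/
def foxRow (a : FreeGroup ι) : Matrix (Fin 1) ι R := Matrix.of fun _ k => Λ (fox k a)

theorem foxRow_mul_augmentationColumn (a : FreeGroup ι) (s : R) (i j : Fin 1) :
    (foxRow Λ a * augmentationColumn Λ s) i j = (Λ (MonoidAlgebra.of ℤ _ a) - 1) * s := by
  rw [fox_fundamental_formula, Finset.sum_mul, Matrix.mul_apply]
  simp [foxRow, augmentationColumn, mul_assoc]

/-- By the fundamental formula the product is $(t(y_i-1)-(z_i-1))s$, and $ty_i=z_it$ lets the
bracket factor as $(z_i-1)(t-1)$. -/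
theorem foxMatrix_mul_augmentationColumn {t : R} {y z : ι → FreeGroup ι}
    (h : ∀ j, t * Λ (MonoidAlgebra.of ℤ _ (y j)) = Λ (MonoidAlgebra.of ℤ _ (z j)) * t)
    (s : R) (i : ι) (j : Fin 1) :
    (foxMatrix Λ t y z * augmentationColumn Λ s) i j =
      (Λ (MonoidAlgebra.of ℤ _ (z i)) - 1) * (t - 1) * s := by
  have e : (Λ (MonoidAlgebra.of ℤ _ (z i)) - 1) * (t - 1) =
      t * (Λ (MonoidAlgebra.of ℤ _ (y i)) - 1) - (Λ (MonoidAlgebra.of ℤ _ (z i)) - 1) := by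
    rw [mul_sub t, h]; noncomm_ring
  rw [e, fox_fundamental_formula Λ (y i), fox_fundamental_formula Λ (z i), Finset.mul_sum,
    ← Finset.sum_sub_distrib, Finset.sum_mul, Matrix.mul_apply]
  refine Finset.sum_congr rfl fun k _ => ?_
  simp only [foxMatrix, augmentationColumn, Matrix.of_apply]
  noncomm_ring

variable {Λ t y z}

/-- Replacing $t$ by $ta$ and conjugating the lower words by $a$ adds $t(y(\psi x_j)-1)\,\partial a$
to row $j$. This term is $J(\psi)$ applied to the rows $(z_i-1)t\,\partial a$. Since $t-1$ is
invertible, these are again a multiple of the Fox matrix, and the change becomes a right factor of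
the form identity plus column times row. -/
theorem foxMatrix_change {t₁ : Rˣ} (ht₁ : (t₁ : R) = t - 1) (ht : IsUnit t)
    (h : ∀ j, t * Λ (MonoidAlgebra.of ℤ _ (y j)) = Λ (MonoidAlgebra.of ℤ _ (z j)) * t)
    {θ ψ : FreeGroup ι ≃* FreeGroup ι} {a : FreeGroup ι} {y' z' : ι → FreeGroup ι}
    (hy : ∀ j, θ (y' j) = a⁻¹ * FreeGroup.lift y (ψ (FreeGroup.of j)) * a)
    (hz : ∀ j, θ (z' j) = FreeGroup.lift z (ψ (FreeGroup.of j))) :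
    foxMatrix (Λ.comp (groupRingMap θ.toMonoidHom)) (t * Λ (MonoidAlgebra.of ℤ _ a)) y' z' *
        jacobian Λ θ.toMonoidHom =
      jacobian (Λ.comp (groupRingMap (FreeGroup.lift z))) ψ.toMonoidHom * foxMatrix Λ t y z *
        (1 + augmentationColumn Λ ((t₁⁻¹ : Rˣ) * t) * foxRow Λ a) := by
  ext j k
  set w := ψ (FreeGroup.of j) with hw
  -- The column is scaled by $s=(t-1)^{-1}t$ precisely to turn the factor $(t-1)s$ into $t$.
  have hX : ∀ i, (foxMatrix Λ t y z * (augmentationColumn Λ ((t₁⁻¹ : Rˣ) * t) * foxRow Λ a)) i k =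
      (Λ (MonoidAlgebra.of ℤ _ (z i)) - 1) * t * Λ (fox k a) := by
    intro i
    rw [← Matrix.mul_assoc, Matrix.mul_apply, Fin.sum_univ_one,
      foxMatrix_mul_augmentationColumn Λ h, ← ht₁, mul_assoc _ (t₁ : R), ← mul_assoc (t₁ : R),
      t₁.mul_inv, one_mul]
    rfl
  -- Both sides come from differentiating $a\cdot\theta(y'_j)=y(w)\cdot a$.
  have hconj : Λ (MonoidAlgebra.of ℤ _ a) * Λ (fox k (θ (y' j))) =
      Λ (fox k (FreeGroup.lift y w)) +
        (Λ (MonoidAlgebra.of ℤ _ (FreeGroup.lift y w)) - 1) * Λ (fox k a) := by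
    have h1 := fox_mul k a (θ (y' j))
    rw [hy, mul_assoc, mul_inv_cancel_left, fox_mul] at h1
    have h2 := congrArg Λ h1
    rw [map_add, map_add, map_mul, map_mul] at h2
    rw [sub_mul, one_mul, add_sub, h2, hy, mul_assoc a⁻¹]
    abel
  have hB : (foxMatrix (Λ.comp (groupRingMap θ.toMonoidHom)) (t * Λ (MonoidAlgebra.of ℤ _ a)) y' z'
      * jacobian Λ θ.toMonoidHom) j k =
      t * (Λ (MonoidAlgebra.of ℤ _ a) * Λ (fox k (θ (y' j)))) - Λ (fox k (θ (z' j))) := by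
    have e1 := fox_chain_rule Λ θ.toMonoidHom k (y' j)
    have e2 := fox_chain_rule Λ θ.toMonoidHom k (z' j)
    change Λ (fox k (θ (y' j))) = _ at e1
    change Λ (fox k (θ (z' j))) = _ at e2
    rw [e1, e2, Finset.mul_sum, Finset.mul_sum, ← Finset.sum_sub_distrib, Matrix.mul_apply]
    refine Finset.sum_congr rfl fun i _ => ?_
    simp only [foxMatrix, jacobian, Matrix.of_apply, RingHom.comp_apply]
    noncomm_ring
  -- Moving $t$ across turns $y(w)$ into $z(w)$, to which the fundamental formula with coefficients
  -- $\Lambda\circ z$ applies.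
  have hZ : t * (Λ (MonoidAlgebra.of ℤ _ (FreeGroup.lift y w)) - 1) =
      ∑ i, Λ (groupRingMap (FreeGroup.lift z) (fox i w)) *
        ((Λ (MonoidAlgebra.of ℤ _ (z i)) - 1) * t) := by
    have e1 := intertwine_of_basis Λ ht h (MonoidAlgebra.of ℤ _ w)
    have e2 := fox_fundamental_formula (Λ.comp (groupRingMap (FreeGroup.lift z))) w
    simp only [groupRingMap_of, RingHom.comp_apply, FreeGroup.lift_apply_of] at e1 e2
    rw [mul_sub, e1, mul_one, ← sub_one_mul, e2, Finset.sum_mul]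
    simp only [mul_assoc]
  rw [hB, hconj, mul_add, ← mul_assoc, hZ, hz, fox_chain_rule Λ (FreeGroup.lift y),
    fox_chain_rule Λ (FreeGroup.lift z), Finset.mul_sum, Finset.sum_mul, Matrix.mul_assoc,
    Matrix.mul_add, Matrix.mul_one, Matrix.mul_apply, ← Finset.sum_add_distrib,
    ← Finset.sum_sub_distrib]
  refine Finset.sum_congr rfl fun i _ => ?_
  rw [Matrix.add_apply, hX, ← mul_assoc t, intertwine_of_basis Λ ht h]
  simp only [foxMatrix, jacobian, Matrix.of_apply, RingHom.comp_apply, FreeGroup.lift_apply_of]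
  change _ = Λ (groupRingMap (FreeGroup.lift z) (fox i w)) * _
  noncomm_ring

end FoxMatrix

/-- The class in `K₁` of the Fox matrix under a change of generators that preserves the conjugacy
class of the stable letter. -/
theorem foxMatrix_change_K1 {R : Type*} [Ring R] (h2 : IsUnit (2 : R)) {m : ℕ}
    {Λ : MonoidAlgebra ℤ (FreeGroup (Fin m)) →+* R} {y z : Fin m → FreeGroup (Fin m)}
    {t t₁ f : Rˣ} (ht₁ : (t₁ : R) = t - 1)
    (h : ∀ j, t * Λ (MonoidAlgebra.of ℤ _ (y j)) = Λ (MonoidAlgebra.of ℤ _ (z j)) * t)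
    {θ ψ : FreeGroup (Fin m) ≃* FreeGroup (Fin m)} {a : FreeGroup (Fin m)}
    {y' z' : Fin m → FreeGroup (Fin m)}
    (hy : ∀ j, θ (y' j) = a⁻¹ * FreeGroup.lift y (ψ (FreeGroup.of j)) * a)
    (hz : ∀ j, θ (z' j) = FreeGroup.lift z (ψ (FreeGroup.of j)))
    (hf : Λ (MonoidAlgebra.of ℤ _ a) * t = f * t * (f⁻¹ : Rˣ)) :
    ∃ E : GLn R m, K1.ofGL m E = 1 ∧
      foxMatrix (Λ.comp (groupRingMap θ.toMonoidHom)) (t * Λ (MonoidAlgebra.of ℤ _ a)) y' z' *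
        (jacobianUnit Λ θ).val =
      (jacobianUnit (Λ.comp (groupRingMap (FreeGroup.lift z))) ψ).val *
        foxMatrix Λ (t : R) y z * E.val := by
  set u := augmentationColumn Λ ((t₁⁻¹ : Rˣ) * (t : R)) with hu
  set v := foxRow Λ a with hv
  -- Since $at=ftf^{-1}$, this commutator equals $(at-1)(t-1)^{-1}=1+(a-1)t(t-1)^{-1}$, which is the
  -- entry of the $1\times1$ matrix $1+vu$.
  let r : Rˣ := f * t₁ * f⁻¹ * t₁⁻¹
  have hr : K1.ofUnit r = 1 := by
    simp only [r, map_mul, map_inv, mul_inv_cancel_comm, mul_inv_cancel]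
  have hcomm : (t₁⁻¹ : Rˣ) * (t : R) = t * (t₁⁻¹ : Rˣ) := by
    have : Commute (t₁ : R) t := by rw [ht₁]; exact (Commute.refl _).sub_left (Commute.one_left _)
    exact (this.units_inv_left).eq
  have hrv : (Λ (MonoidAlgebra.of ℤ _ a) - 1) * ((t₁⁻¹ : Rˣ) * (t : R)) = r.val - 1 := by
    have e : (r.val - 1) * t₁ = (Λ (MonoidAlgebra.of ℤ _ a) - 1) * t := by
      simp only [r, sub_mul, Units.val_mul, one_mul]
      rw [mul_assoc _ _ (t₁ : R), t₁.inv_mul, mul_one, ht₁, mul_sub, sub_mul, hf, mul_one,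
        f.mul_inv]
      abel
    rw [hcomm, ← mul_assoc, ← e, mul_assoc, t₁.mul_inv, mul_one]
  have hN : (Units.map (Matrix.scalar (Fin 1)).toMonoidHom r : GLn R 1).val = 1 + v * u := by
    ext i j
    rw [Matrix.add_apply, foxRow_mul_augmentationColumn, hrv, Subsingleton.elim i j]
    simp
  obtain ⟨E, hE⟩ := K1.isUnit_one_add_mul u v ⟨_, hN⟩
  exact ⟨E, (K1.ofGL_one_add_mul h2 u v E _ hE hN).trans hr,
    by rw [hE]; exact foxMatrix_change ht₁ t.isUnit h hy hz⟩

end KnotLog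

/-! ### Path classes, connectedness of the surface, conjugacy of meridians -/

namespace KnotLog

open Path

/-! ### Transport of loops along classes of paths -/

section Transport

variable {X Y : Type*} [TopologicalSpace X] [TopologicalSpace Y] {x y z w : X}

theorem symm_trans_cancel (p : Homotopic.Quotient x y) (q : Homotopic.Quotient y z) :
    p.symm.trans (p.trans q) = q := by
  rw [← Homotopic.Quotient.trans_assoc, Homotopic.Quotient.symm_trans, Homotopic.Quotient.refl_trans]

theorem trans_symm_cancel (p : Homotopic.Quotient y x) (q : Homotopic.Quotient y z) :
    p.trans (p.symm.trans q) = q := by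
  rw [← Homotopic.Quotient.trans_assoc, Homotopic.Quotient.trans_symm, Homotopic.Quotient.refl_trans]

theorem symm_symm_class (p : Homotopic.Quotient x y) : p.symm.symm = p := by
  induction p using Homotopic.Quotient.ind with
  | mk p => simp [← Homotopic.Quotient.mk_symm]

theorem trans_symm_rev (p : Homotopic.Quotient x y) (q : Homotopic.Quotient y z) :
    (p.trans q).symm = q.symm.trans p.symm := by
  rw [← symm_trans_cancel (p.trans q) (q.symm.trans p.symm), Homotopic.Quotient.trans_assoc p,
    trans_symm_cancel, Homotopic.Quotient.trans_symm, Homotopic.Quotient.trans_refl]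

theorem map_trans_class (f : C(X, Y)) (p : Homotopic.Quotient x y) (q : Homotopic.Quotient y z) :
    (p.trans q).map f = (p.map f).trans (q.map f) := by
  induction p using Homotopic.Quotient.ind with
  | mk p =>
  induction q using Homotopic.Quotient.ind with
  | mk q =>
  rw [← Homotopic.Quotient.mk_trans, ← Homotopic.Quotient.mk_map, ← Homotopic.Quotient.mk_map, ← Homotopic.Quotient.mk_map,
    ← Homotopic.Quotient.mk_trans, Path.map_trans]

theorem map_symm_class (f : C(X, Y)) (p : Homotopic.Quotient x y) :
    p.symm.map f = (p.map f).symm := by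
  induction p using Homotopic.Quotient.ind with
  | mk p => rfl

/-- A homotopy of maps intertwines the images of a class of paths. -/
theorem map_trans_evalAt_class {f g : C(X, Y)} (H : f.Homotopy g) (p : Homotopic.Quotient x y) :
    (p.map f).trans (Homotopic.Quotient.mk (H.evalAt y)) = (Homotopic.Quotient.mk (H.evalAt x)).trans (p.map g) := by
  induction p using Homotopic.Quotient.ind with
  | mk p => exact Homotopic.Quotient.eq.2 (Path.Homotopic.map_trans_evalAt H p)

namespace Pi1

/-- The element of the fundamental group given by a class of loops. -/
def ofClass (p : Homotopic.Quotient x x) : Pi1 X x := MulOpposite.op (FundamentalGroup.fromPath p)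

/-- The class of loops that represents an element of the fundamental group. -/
def toClass (u : Pi1 X x) : Homotopic.Quotient x x := FundamentalGroup.toPath u.unop

@[simp] theorem toClass_ofClass (p : Homotopic.Quotient x x) : toClass (ofClass p) = p := rfl
@[simp] theorem ofClass_toClass (u : Pi1 X x) : ofClass (toClass u) = u := rfl
@[simp] theorem toClass_mul (u v : Pi1 X x) : toClass (u * v) = (toClass u).trans (toClass v) := rfl
@[simp] theorem toClass_inv (u : Pi1 X x) : toClass u⁻¹ = (toClass u).symm := rfl
@[simp] theorem toClass_transport (α : Path x y) (u : Pi1 X y) :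
    toClass (transport α u) =
      (Homotopic.Quotient.mk α).trans ((toClass u).trans (Homotopic.Quotient.mk α).symm) := rfl
@[simp] theorem toClass_ofLoop (p : Path x x) : toClass (ofLoop p) = Homotopic.Quotient.mk p := rfl
@[simp] theorem toClass_map (f : C(X, Y)) (u : Pi1 X x) :
    toClass (map f x u) = (toClass u).map f := rfl

theorem toClass_injective : Function.Injective (toClass : Pi1 X x → Homotopic.Quotient x x) :=
  fun _ _ h => congrArg ofClass h

/-- Transport along a class of paths, as an isomorphism of fundamental groups. -/
def transportEquiv (q : Homotopic.Quotient x y) : Pi1 X y ≃* Pi1 X x where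
  toFun u := ofClass (q.trans ((toClass u).trans q.symm))
  invFun u := ofClass (q.symm.trans ((toClass u).trans q))
  left_inv u := toClass_injective (by
    simp [symm_trans_cancel])
  right_inv u := toClass_injective (by
    simp [trans_symm_cancel])
  map_mul' u v := toClass_injective (by
    simp [symm_trans_cancel])

@[simp] theorem toClass_transportEquiv (q : Homotopic.Quotient x y) (u : Pi1 X y) :
    toClass (transportEquiv q u) = q.trans ((toClass u).trans q.symm) := rfl

theorem transport_eq (α : Path x y) (u : Pi1 X y) :
    transport α u = transportEquiv (Homotopic.Quotient.mk α) u := rfl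

end Pi1

end Transport

/-! ### The interior of the surface is path connected -/

/-- The gluing of the polygon takes place on its boundary, so that points of the open disc are
only identified with themselves. -/
theorem norm_eq_of_eqvGen {g : ℕ} {x y : Disc} (h : Relation.EqvGen (SurfaceRel g) x y) :
    ‖(x : ℂ)‖ = ‖(y : ℂ)‖ := by
  have hb : ∀ t, ‖(polygonPoint g t : ℂ)‖ = 1 := fun t => Circle.norm_coe _
  induction h with
  | rel _ _ h => cases h <;> rw [hb, hb]
  | refl => rfl
  | symm _ _ _ ih => exact ih.symm
  | trans _ _ _ _ _ h1 h2 => exact h1.trans h2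

theorem mk_notMem_surfaceBoundary {g : ℕ} {x : Disc} (hx : ‖(x : ℂ)‖ < 1) :
    Quot.mk (SurfaceRel g) x ∉ surfaceBoundary g := by
  rintro ⟨t, _, ht⟩
  have h := norm_eq_of_eqvGen (Quot.eqvGen_exact ht)
  have hb : ‖(polygonPoint g t : ℂ)‖ = 1 := Circle.norm_coe _
  linarith

/-- Shrink a representative radially to the centre of the polygon. The starting point avoids the
boundary circle by assumption, and all later points lie in the open disc, where nothing is glued. -/
theorem joined_center {g : ℕ} (s : SurfaceInterior g) :
    Joined s ⟨Quot.mk _ ⟨0, by simp⟩, mk_notMem_surfaceBoundary (by simp)⟩ := by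
  obtain ⟨s, hs⟩ := s
  obtain ⟨x, rfl⟩ := Quot.exists_rep s
  have hx : ‖(x : ℂ)‖ ≤ 1 := mem_closedBall_zero_iff.1 x.2
  have hn : ∀ t : unitInterval, ‖((1 - (t : ℝ) : ℝ) : ℂ) * x‖ = (1 - t) * ‖(x : ℂ)‖ := fun t => by
    rw [norm_mul, Complex.norm_real, Real.norm_of_nonneg (by linarith [t.2.2])]
  let q : unitInterval → Disc := fun t => ⟨((1 - (t : ℝ) : ℝ) : ℂ) * x, by
    rw [mem_closedBall_zero_iff, hn]
    nlinarith [t.2.1, t.2.2, norm_nonneg (x : ℂ)]⟩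
  have hq : Continuous q := by fun_prop
  have hq0 : q 0 = x := by simp [q]
  have hmem : ∀ t, Quot.mk (SurfaceRel g) (q t) ∉ surfaceBoundary g := by
    intro t
    rcases eq_or_ne t 0 with rfl | ht
    · rwa [hq0]
    · have h0 : 0 < (t : ℝ) := unitInterval.pos_iff_ne_zero.2 ht
      refine mk_notMem_surfaceBoundary ?_
      change ‖((1 - (t : ℝ) : ℝ) : ℂ) * x‖ < 1
      rw [hn]
      nlinarith [t.2.2, norm_nonneg (x : ℂ)]
  exact ⟨{ toFun := fun t => ⟨Quot.mk _ (q t), hmem t⟩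
           continuous_toFun := (continuous_quot_mk.comp hq).subtype_mk hmem
           source' := Subtype.ext (congrArg (Quot.mk _) hq0)
           target' := Subtype.ext (congrArg (Quot.mk _) (by simp [q])) }⟩

theorem joined_surfaceInterior {g : ℕ} (s s' : SurfaceInterior g) : Joined s s' :=
  (joined_center s).trans (joined_center s').symm

/-! ### Meridians are conjugate -/

namespace Knot

variable (K : Knot)

/-- The fibre circle over a point of the core, on the boundary of the tubular neighbourhood. -/
def fibre (θ : Circle) : C(Circle, K.Complement) where
  toFun z := ⟨K.tube (θ, circleToDisc z), K.tube_notMem θ z⟩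
  continuous_toFun := by fun_prop

/-- The standard generator of the fundamental group of the circle. -/
def circleLoop : Path (1 : Circle) 1 where
  toFun t := Circle.exp (2 * Real.pi * t)
  continuous_toFun := by fun_prop
  source' := by simp
  target' := by simp

/-- A path on the core moves the fibre circles. -/
def fibreHomotopy {θ θ' : Circle} (p : Path θ θ') : (K.fibre θ).Homotopy (K.fibre θ') where
  toFun q := ⟨K.tube (p q.1, circleToDisc q.2), K.tube_notMem _ _⟩
  continuous_toFun := by fun_prop
  map_zero_left z := by simp [fibre]
  map_one_left z := by simp [fibre]

/-- The core circle is path connected, so one fibre circle can be slid to the other through the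
boundary of the tube, which preserves its sense. -/
theorem IsMeridian.exists_conj {b : K.Complement} {m m' : K.group b} (h : K.IsMeridian m)
    (h' : K.IsMeridian m') : ∃ e, m' = e * m * e⁻¹ := by
  obtain ⟨θ, γ, rfl⟩ := h
  obtain ⟨θ', γ', rfl⟩ := h'
  obtain ⟨p⟩ : Joined θ' θ := PathConnectedSpace.joined _ _
  have hp := map_trans_evalAt_class (K.fibreHomotopy p) (Homotopic.Quotient.mk circleLoop)
  set q : Homotopic.Quotient (K.fibre θ' 1) (K.fibre θ 1) := Homotopic.Quotient.mk ((K.fibreHomotopy p).evalAt 1)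
  let r : Homotopic.Quotient b (K.fibre θ' 1) := Homotopic.Quotient.mk γ'
  let s : Homotopic.Quotient b (K.fibre θ 1) := Homotopic.Quotient.mk γ
  -- The conjugator goes out along $\gamma'$, over the boundary of the tube to the other fibre, and
  -- back along $\gamma$.
  refine ⟨Pi1.ofClass (r.trans (q.trans s.symm)), Pi1.toClass_injective ?_⟩
  have e : ((Homotopic.Quotient.mk circleLoop).map (K.fibre θ')) =
      q.trans (((Homotopic.Quotient.mk circleLoop).map (K.fibre θ)).trans q.symm) := by
    rw [← Homotopic.Quotient.trans_assoc, ← hp, Homotopic.Quotient.trans_assoc, Homotopic.Quotient.trans_symm,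
      Homotopic.Quotient.trans_refl]
  change r.trans (((Homotopic.Quotient.mk circleLoop).map (K.fibre θ')).trans r.symm) =
    ((r.trans (q.trans s.symm)).trans (s.trans
      (((Homotopic.Quotient.mk circleLoop).map (K.fibre θ)).trans s.symm))).trans
        (r.trans (q.trans s.symm)).symm
  rw [e]
  simp only [trans_symm_rev, Homotopic.Quotient.trans_assoc, symm_trans_cancel, symm_symm_class]

end Knot

end KnotLog

/-! ### Comparison of two systems of choices in the knot group -/

namespace KnotLog

open Path

namespace SeifertSurface

variable {K : Knot} {g : ℕ} (F : SeifertSurface K g)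

/-- The straight arcs through the surface as a homotopy from the upper to the lower push-off. -/
def crossingHomotopy : (F.incl.comp F.sharp).Homotopy (F.incl.comp F.flat) where
  toFun q := F.crossing q.2 q.1
  continuous_toFun := by
    refine Continuous.subtype_mk ?_ _
    fun_prop
  map_zero_left s := (F.crossing s).source
  map_one_left s := (F.crossing s).target

/-- The class of the straight arc through the surface. -/
def crossingClass (s : SurfaceInterior g) :
    Homotopic.Quotient (F.incl (F.sharp s)) (F.incl (F.flat s)) :=
  Homotopic.Quotient.mk (F.crossing s)

/-- Naturality of the homotopy through the collar: a path on $F$ may be followed above the surface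
before crossing, or below it after crossing. -/
theorem map_trans_crossingClass {s s' : SurfaceInterior g} (q : Homotopic.Quotient s s') :
    ((q.map F.sharp).map F.incl).trans (F.crossingClass s') =
      (F.crossingClass s).trans ((q.map F.flat).map F.incl) := by
  have h := map_trans_evalAt_class F.crossingHomotopy q
  rw [Homotopic.Quotient.map_comp, Homotopic.Quotient.map_comp] at h
  exact h

namespace Generators

variable {F} {b : K.Complement} (D : F.Generators b)

/-- The isomorphism of the free group on `u_1, …, u_{2g}` with `π₁(F)`. -/
def surfaceEquiv : FreeGroup (Fin (2 * g)) ≃* Pi1 (SurfaceInterior g) D.p :=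
  MulEquiv.ofBijective (FreeGroup.lift D.u) D.u_basis

theorem lift_gen (w : FreeGroup (Fin (2 * g))) :
    FreeGroup.lift D.gen w = Pi1.transport D.α (Pi1.map F.incl D.v (D.freeEquiv w)) := by
  have : FreeGroup.lift D.gen =
      ((Pi1.transportEquiv (Homotopic.Quotient.mk D.α)).toMonoidHom.comp
        (Pi1.map F.incl D.v)).comp (FreeGroup.lift D.x) :=
    FreeGroup.ext_hom _ _ fun i => by simp [gen, Pi1.transport_eq]
  exact DFunLike.congr_fun this w

theorem freeEquiv_lift_y (w : FreeGroup (Fin (2 * g))) :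
    D.freeEquiv (FreeGroup.lift D.y w) =
      Pi1.transport D.βflat (Pi1.map F.flat D.p (D.surfaceEquiv w)) := by
  have : D.freeEquiv.toMonoidHom.comp (FreeGroup.lift D.y) =
      ((Pi1.transportEquiv (Homotopic.Quotient.mk D.βflat)).toMonoidHom.comp
        (Pi1.map F.flat D.p)).comp (FreeGroup.lift D.u) :=
    FreeGroup.ext_hom _ _ fun i => by simp [y, Pi1.transport_eq]
  exact DFunLike.congr_fun this w

theorem freeEquiv_lift_z (w : FreeGroup (Fin (2 * g))) :
    D.freeEquiv (FreeGroup.lift D.z w) =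
      Pi1.transport D.βsharp (Pi1.map F.sharp D.p (D.surfaceEquiv w)) := by
  have : D.freeEquiv.toMonoidHom.comp (FreeGroup.lift D.z) =
      ((Pi1.transportEquiv (Homotopic.Quotient.mk D.βsharp)).toMonoidHom.comp
        (Pi1.map F.sharp D.p)).comp (FreeGroup.lift D.u) :=
    FreeGroup.ext_hom _ _ fun i => by simp [z, Pi1.transport_eq]
  exact DFunLike.congr_fun this w

/-- The class of the path `α`. -/
abbrev αClass : Homotopic.Quotient b (F.incl D.v) := Homotopic.Quotient.mk D.α

/-- The class of the path `β^♯`. -/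
abbrev sharpClass : Homotopic.Quotient D.v (F.sharp D.p) := Homotopic.Quotient.mk D.βsharp

/-- The class of the path `β^♭`. -/
abbrev flatClass : Homotopic.Quotient D.v (F.flat D.p) := Homotopic.Quotient.mk D.βflat

theorem toClass_meridian : Pi1.toClass D.meridian =
    D.αClass.trans (((D.sharpClass.map F.incl).trans ((F.crossingClass D.p).trans
      (D.flatClass.map F.incl).symm)).trans D.αClass.symm) := by
  rw [← Homotopic.Quotient.trans_assoc (D.sharpClass.map F.incl)]
  rfl

theorem toClass_lift_gen (w : FreeGroup (Fin (2 * g))) :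
    Pi1.toClass (FreeGroup.lift D.gen w) =
      D.αClass.trans (((Pi1.toClass (D.freeEquiv w)).map F.incl).trans D.αClass.symm) := by
  rw [lift_gen]; rfl

theorem toClass_freeEquiv_lift_y (w : FreeGroup (Fin (2 * g))) :
    Pi1.toClass (D.freeEquiv (FreeGroup.lift D.y w)) =
      D.flatClass.trans (((Pi1.toClass (D.surfaceEquiv w)).map F.flat).trans
        D.flatClass.symm) := by
  rw [freeEquiv_lift_y]; rfl

theorem toClass_freeEquiv_lift_z (w : FreeGroup (Fin (2 * g))) :
    Pi1.toClass (D.freeEquiv (FreeGroup.lift D.z w)) =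
      D.sharpClass.trans (((Pi1.toClass (D.surfaceEquiv w)).map F.sharp).trans
        D.sharpClass.symm) := by
  rw [freeEquiv_lift_z]; rfl

/-- The relation `𝔪 y_j = z_j 𝔪` in the knot group. -/
theorem meridian_mul_lift_y (w : FreeGroup (Fin (2 * g))) :
    D.meridian * FreeGroup.lift D.gen (FreeGroup.lift D.y w) =
      FreeGroup.lift D.gen (FreeGroup.lift D.z w) * D.meridian := by
  apply Pi1.toClass_injective
  rw [Pi1.toClass_mul, Pi1.toClass_mul, toClass_meridian, toClass_lift_gen, toClass_lift_gen,
    toClass_freeEquiv_lift_y, toClass_freeEquiv_lift_z]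
  have h := F.map_trans_crossingClass (Pi1.toClass (D.surfaceEquiv w))
  simp only [map_trans_class, map_symm_class, Homotopic.Quotient.trans_assoc, symm_trans_cancel]
  rw [← Homotopic.Quotient.trans_assoc (F.crossingClass D.p), ← h, Homotopic.Quotient.trans_assoc]

/-- The comparison of two systems of choices: both bases change by automorphisms of the free
group, and the meridian changes by a conjugation and a factor from `π₁(S³ \ F)`. -/
theorem exists_change (D D' : F.Generators b) :
    ∃ (θ ψ : FreeGroup (Fin (2 * g)) ≃* FreeGroup (Fin (2 * g))) (a : FreeGroup (Fin (2 * g)))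
      (h : K.group b),
      (∀ w, FreeGroup.lift D.gen (θ w) = h * FreeGroup.lift D'.gen w * h⁻¹) ∧
      (∀ j, θ (D'.y j) = a⁻¹ * FreeGroup.lift D.y (ψ (FreeGroup.of j)) * a) ∧
      (∀ j, θ (D'.z j) = FreeGroup.lift D.z (ψ (FreeGroup.of j))) ∧
      D.meridian * FreeGroup.lift D.gen a = h * D'.meridian * h⁻¹ := by
  obtain ⟨δ⟩ := joined_surfaceInterior D.p D'.p
  let d : Homotopic.Quotient D.p D'.p := Homotopic.Quotient.mk δ
  -- The base points off $F$ are joined through the upper side. The upper words then correspond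
  -- without a conjugation, and the whole discrepancy falls on the lower side, where the loop `A`
  -- measures it.
  let η : Homotopic.Quotient D.v D'.v :=
    D.sharpClass.trans ((d.map F.sharp).trans D'.sharpClass.symm)
  let A : Homotopic.Quotient D.v D.v :=
    D.flatClass.trans ((d.map F.flat).trans (D'.flatClass.symm.trans η.symm))
  refine ⟨D'.freeEquiv.trans ((Pi1.transportEquiv η).trans D.freeEquiv.symm),
    D'.surfaceEquiv.trans ((Pi1.transportEquiv d).trans D.surfaceEquiv.symm),
    D.freeEquiv.symm (Pi1.ofClass A),
    Pi1.ofClass (D.αClass.trans ((η.map F.incl).trans D'.αClass.symm)), ?_, ?_, ?_, ?_⟩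
  · intro w
    apply Pi1.toClass_injective
    simp only [Pi1.toClass_mul, Pi1.toClass_inv, Pi1.toClass_ofClass, toClass_lift_gen,
      MulEquiv.trans_apply, MulEquiv.apply_symm_apply, Pi1.toClass_transportEquiv,
      map_trans_class, map_symm_class, Homotopic.Quotient.trans_assoc, symm_trans_cancel,
      trans_symm_rev, symm_symm_class]
  · intro j
    apply D.freeEquiv.injective
    apply Pi1.toClass_injective
    have hy : D'.y j = FreeGroup.lift D'.y (FreeGroup.of j) := FreeGroup.lift_apply_of.symm
    simp only [hy, map_mul, map_inv, Pi1.toClass_mul, Pi1.toClass_inv, Pi1.toClass_ofClass,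
      MulEquiv.trans_apply, MulEquiv.apply_symm_apply, Pi1.toClass_transportEquiv,
      toClass_freeEquiv_lift_y, A,
      map_trans_class, map_symm_class, Homotopic.Quotient.trans_assoc, symm_trans_cancel,
      trans_symm_rev, symm_symm_class]
  · intro j
    apply D.freeEquiv.injective
    apply Pi1.toClass_injective
    have hz : D'.z j = FreeGroup.lift D'.z (FreeGroup.of j) := FreeGroup.lift_apply_of.symm
    simp only [hz,
      MulEquiv.trans_apply, MulEquiv.apply_symm_apply, Pi1.toClass_transportEquiv,
      toClass_freeEquiv_lift_z, η,
      map_trans_class, map_symm_class, Homotopic.Quotient.trans_assoc, symm_trans_cancel,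
      trans_symm_rev, symm_symm_class]
  · apply Pi1.toClass_injective
    have h := F.map_trans_crossingClass d
    simp only [Pi1.toClass_mul, Pi1.toClass_inv, Pi1.toClass_ofClass, toClass_lift_gen,
      MulEquiv.apply_symm_apply, toClass_meridian, A, η,
      map_trans_class, map_symm_class, Homotopic.Quotient.trans_assoc, symm_trans_cancel,
      trans_symm_rev, symm_symm_class]
    rw [← Homotopic.Quotient.trans_assoc (F.crossingClass D.p), ← h,
      Homotopic.Quotient.trans_assoc]

end Generators
end SeifertSurface

end KnotLog

/-! ### Change of indeterminate, and invariance of the class in `Q` -/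

namespace KnotLog

namespace Novikov

variable {A : Type*} [Ring A] {κ : RingAut A}

/-! ### Some units -/

/-- The unit `τ - 1` of the Novikov ring. -/
def tauSubOne (κ : RingAut A) : (Novikov κ)ˣ where
  val := (τ κ : Novikov κ) - 1
  -- The geometric series $-\sum_{n\ge0}\tau^n$.
  inv := mk κ (fun n => if 0 ≤ n then -1 else 0) ⟨0, fun n hn => if_neg (by omega)⟩
  val_inv := by
    ext n
    rw [sub_mul, one_mul, coeff_sub]
    change (monomial κ 1 1 * _).coeff n - _ = _
    rw [coeff_monomial_mul, one_def, coeff_monomial, coeff_mk, coeff_mk]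
    split_ifs <;> first | omega | simp
  inv_val := by
    ext n
    rw [mul_sub, mul_one, coeff_sub]
    change (_ * monomial κ 1 1).coeff n - _ = _
    rw [coeff_mul_monomial, one_def, coeff_monomial, coeff_mk, coeff_mk]
    split_ifs <;> first | omega | simp

/-- The degree-zero coefficient of the inverse series is already an inverse in `A`. -/
theorem isUnit_of_isUnit_C {a : A} (h : IsUnit (C κ a)) : IsUnit a := by
  obtain ⟨u, hu⟩ := h
  have h1 : (C κ a * u⁻¹.val).coeff 0 = 1 := by
    rw [← hu, u.mul_inv, one_def, coeff_monomial, if_pos rfl]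
  have h2 : (u⁻¹.val * C κ a).coeff 0 = 1 := by
    rw [← hu, u.inv_mul, one_def, coeff_monomial, if_pos rfl]
  change (monomial κ 0 a * _).coeff 0 = 1 at h1
  change (_ * monomial κ 0 a).coeff 0 = 1 at h2
  rw [coeff_monomial_mul] at h1
  rw [coeff_mul_monomial] at h2
  exact ⟨⟨a, u⁻¹.val.coeff 0, by simpa using h1, by simpa using h2⟩, rfl⟩

theorem isUnit_two [Algebra ℚ A] : IsUnit (2 : Novikov κ) := by
  have h : IsUnit (algebraMap ℚ A 2) := (IsUnit.mk0 (2 : ℚ) (by norm_num)).map _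
  have h2 := h.map (C κ)
  rwa [map_ofNat, map_ofNat] at h2

/-- A homomorphism from the integral group ring of a free group that is constant on the generators
takes values in the constants. -/
theorem exists_factor_C {ι : Type*} (Λ : MonoidAlgebra ℤ (FreeGroup ι) →+* Novikov κ)
    (h : ∀ i, ∃ a, Λ (MonoidAlgebra.of ℤ _ (FreeGroup.of i)) = C κ a) :
    ∃ Λ₀ : MonoidAlgebra ℤ (FreeGroup ι) →+* A, Λ = (C κ).comp Λ₀ := by
  choose a ha using h
  have hu : ∀ i, IsUnit (a i) := fun i => isUnit_of_isUnit_C (κ := κ) (by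
    rw [← ha]
    exact ((Group.isUnit (FreeGroup.of i)).map (MonoidAlgebra.of ℤ _)).map Λ)
  let φ : FreeGroup ι →* A := (Units.coeHom A).comp (FreeGroup.lift fun i => (hu i).unit)
  refine ⟨(MonoidAlgebra.lift ℤ A (FreeGroup ι) φ).toRingHom, groupRing_hom_ext fun x => ?_⟩
  have : Λ.toMonoidHom.comp (MonoidAlgebra.of ℤ _) = (C κ).toMonoidHom.comp φ := by
    refine FreeGroup.ext_hom _ _ fun i => ?_
    simpa [φ] using ha i
  simpa using DFunLike.congr_fun this x

/-! ### The change of indeterminate as an isomorphism -/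

/-- Coefficientwise the substitution is right multiplication by the units $N_n(c)$. -/
theorem subst_bijective (κ : RingAut A) (c : Aˣ) : Function.Bijective (subst κ c) := by
  constructor
  · intro f f' h
    ext n
    have := congrArg (fun x => x.coeff n) h
    simpa using this
  · intro f
    obtain ⟨N, hN⟩ := f.bdd
    refine ⟨mk _ (fun n => f.coeff n * ((normUnit κ c n)⁻¹ : Aˣ)) ⟨N, fun n hn => ?_⟩, ?_⟩
    · simp [hN n hn]
    · ext n
      simp

/-- The change of indeterminate as an isomorphism. -/
def substEquiv (κ : RingAut A) (c : Aˣ) : Novikov (twist κ c) ≃+* Novikov κ :=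
  RingEquiv.ofBijective (subst κ c) (subst_bijective κ c)

theorem coeff_substEquiv_symm (c : Aˣ) (f : Novikov κ) (n : ℤ) :
    ((substEquiv κ c).symm f).coeff n = f.coeff n * ((normUnit κ c n)⁻¹ : Aˣ) := by
  have h : (subst κ c ((substEquiv κ c).symm f)).coeff n = f.coeff n :=
    congrArg (fun x => x.coeff n) ((substEquiv κ c).apply_symm_apply f)
  rw [← h, coeff_subst, mul_assoc, Units.mul_inv, mul_one]

theorem substEquiv_symm_mem_powerSeries (c : Aˣ) {f : Novikov κ} (hf : f ∈ powerSeries κ) :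
    (substEquiv κ c).symm f ∈ powerSeries (twist κ c) := fun n hn => by
  rw [coeff_substEquiv_symm, hf n hn, zero_mul]

/-- Witt vectors after a change of indeterminate. -/
def wittSubst (c : Aˣ) (w : witt κ) : witt (twist κ c) :=
  ⟨{ val := ⟨_, substEquiv_symm_mem_powerSeries c w.1.val.2⟩
     inv := ⟨_, substEquiv_symm_mem_powerSeries c w.1.inv.2⟩
     val_inv := Subtype.ext (by
      change (substEquiv κ c).symm _ * (substEquiv κ c).symm _ = 1
      rw [← map_mul, ← Subring.coe_mul, w.1.val_inv]
      exact map_one _)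
     inv_val := Subtype.ext (by
      change (substEquiv κ c).symm _ * (substEquiv κ c).symm _ = 1
      rw [← map_mul, ← Subring.coe_mul, w.1.inv_val]
      exact map_one _) }, by
    have h : (w.1.val : Novikov κ).coeff 0 = 1 := w.2
    change ((substEquiv κ c).symm _).coeff 0 = 1
    rw [coeff_substEquiv_symm, h, normUnit_zero]
    simp⟩

theorem wittUnit_wittSubst (c : Aˣ) (w : witt κ) :
    wittUnit (twist κ c) (wittSubst c w) =
      Units.map (substEquiv κ c).symm.toRingHom.toMonoidHom (wittUnit κ w) :=
  Units.ext rfl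

theorem Pbar.subst_mk (c : Aˣ) (n : ℕ) (a : A) :
    Pbar.subst κ c n (Pbar.mk (twist κ c) n a) = Pbar.mk κ n (a * normUnit κ c n) := by
  refine congrArg QuotientAddGroup.mk (Subtype.ext ?_)
  change Novikov.subst κ c (monomial _ n a) = monomial κ n _
  ext k
  by_cases h : k = n <;> simp [coeff_monomial, h]

/-- The logarithm is built from ring operations and rational factors, all of which the substitution
respects. -/
theorem subst_logCoeff_wittSubst [Algebra ℚ A] (c : Aˣ) (k : ℕ) (w : witt κ) :
    Pbar.subst κ c k (logCoeff k (wittSubst c w)) = logCoeff k w := by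
  rw [logCoeff, Pbar.subst_mk, logCoeff, Finset.sum_mul]
  refine congrArg _ (Finset.sum_congr rfl fun r _ => ?_)
  rw [smul_mul_assoc]
  congr 1
  rw [← coeff_subst, map_pow, map_sub, map_one]
  congr 3
  exact (substEquiv κ c).apply_symm_apply _

end Novikov

/-! ### Functoriality of `Q_{A,κ}` -/

section QMap

open Novikov

variable {A : Type*} [Ring A] {κ κ' : RingAut A}

/-- The homomorphism of `Q_{A,κ}` induced by a ring homomorphism that is the identity on `A`. -/
def Q.map (f : Novikov κ →+* Novikov κ') (hf : f.comp (C κ) = C κ') : Q κ →* Q κ' :=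
  QuotientGroup.map _ _ (K1.map f) fun x hx => by
    obtain ⟨y, rfl⟩ := hx
    exact ⟨y, by rw [K1.map_map, hf]⟩

theorem Q.map_mk (f : Novikov κ →+* Novikov κ') (hf : f.comp (C κ) = C κ') (x : K1 (Novikov κ)) :
    Q.map f hf (QuotientGroup.mk x) = QuotientGroup.mk (K1.map f x) := rfl

theorem Q.mk_map_C (x : K1 A) : (QuotientGroup.mk (K1.map (C κ) x) : Q κ) = 1 :=
  (QuotientGroup.eq_one_iff _).2 ⟨x, rfl⟩

theorem subst_comp_C (κ : RingAut A) (c : Aˣ) : (subst κ c).comp (C (twist κ c)) = C κ :=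
  RingHom.ext fun a => subst_C κ c a

theorem substEquiv_symm_comp_C (κ : RingAut A) (c : Aˣ) :
    (substEquiv κ c).symm.toRingHom.comp (C κ) = C (twist κ c) :=
  RingHom.ext fun a => (substEquiv κ c).symm_apply_eq.2 (subst_C κ c a).symm

theorem Q.map_symm_map_subst (c : Aˣ) (q : Q (twist κ c)) :
    Q.map _ (substEquiv_symm_comp_C κ c) (Q.map _ (subst_comp_C κ c) q) = q := by
  obtain ⟨x, rfl⟩ := QuotientGroup.mk_surjective q
  rw [Q.map_mk, Q.map_mk, K1.map_map]
  have : (substEquiv κ c).symm.toRingHom.comp (subst κ c) = RingHom.id _ :=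
    RingHom.ext fun f => (substEquiv κ c).symm_apply_apply f
  rw [this, K1.map_id', MonoidHom.id_apply]

end QMap

/-! ### The invariant under a change of the generators -/

namespace SeifertSurface.Generators

open Novikov

variable {K : Knot} {g : ℕ} {F : SeifertSurface K g} {b : K.Complement}
  {A : Type*} [Ring A] {κ : RingAut A}

theorem wordMap_of (D : F.Generators b) (ρ : MonoidAlgebra ℤ (K.group b) →+* Novikov κ)
    (w : FreeGroup (Fin (2 * g))) :
    D.wordMap ρ (MonoidAlgebra.of ℤ _ w) = ρ (MonoidAlgebra.of ℤ _ (FreeGroup.lift D.gen w)) := by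
  rw [wordMap, RingHom.comp_apply]
  exact congrArg ρ (groupRingMap_of _ w)

/-- The Alexander matrices of two systems of choices agree up to factors whose classes cancel in
`Q_{A,κ}`. -/
theorem exists_alexanderMatrix_change [Algebra ℚ A] {D D' : F.Generators b}
    {ρ : MonoidAlgebra ℤ (K.group b) →+* Novikov κ} (hρ : D.Adapted ρ) (c : Aˣ)
    (ρ' : MonoidAlgebra ℤ (K.group b) →+* Novikov (twist κ c)) (hρ' : D'.Adapted ρ')
    (hc : (subst κ c).comp ρ' = ρ) :
    ∃ L M : GLn (Novikov κ) (2 * g),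
      (subst κ c).mapMatrix (D'.alexanderMatrix ρ') * M.val = L.val * D.alexanderMatrix ρ ∧
      (QuotientGroup.mk (K1.ofGL _ L) : Q κ) = QuotientGroup.mk (K1.ofGL _ M) := by
  obtain ⟨θ, ψ, a, h, h1, h2, h3, h4⟩ := exists_change D D'
  obtain ⟨e, he⟩ := Knot.IsMeridian.exists_conj K D.isMeridian D'.isMeridian
  replace he : D'.meridian = e * D.meridian * e⁻¹ := he
  set Λ := D.wordMap ρ with hΛ
  obtain ⟨Λ₀, hΛ₀⟩ := exists_factor_C Λ fun i => by
    rw [hΛ, wordMap_of, FreeGroup.lift_apply_of]; exact hρ.map_gen i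
  let U : K.group b →* (Novikov κ)ˣ := (ρ.toMonoidHom.comp (MonoidAlgebra.of ℤ _)).toHomUnits
  have hU : ∀ x, (U x : Novikov κ) = ρ (MonoidAlgebra.of ℤ _ x) := fun _ => rfl
  have hUm : U D.meridian = τ κ := Units.ext hρ.map_meridian
  have hUa : ∀ w, (U (FreeGroup.lift D.gen w) : Novikov κ) = Λ (MonoidAlgebra.of ℤ _ w) :=
    fun w => (D.wordMap_of ρ w).symm
  have hrel : ∀ j, (τ κ : Novikov κ) * Λ (MonoidAlgebra.of ℤ _ (D.y j)) =
      Λ (MonoidAlgebra.of ℤ _ (D.z j)) * τ κ := fun j => by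
    have := congrArg U (D.meridian_mul_lift_y (FreeGroup.of j))
    rw [map_mul, map_mul, hUm, FreeGroup.lift_apply_of, FreeGroup.lift_apply_of] at this
    simpa [hUa] using congrArg Units.val this
  -- With $\mathfrak m a=h\mathfrak m'h^{-1}$ and $\mathfrak m'=e\mathfrak m e^{-1}$ one gets
  -- $a\mathfrak m=\mathfrak m^{-1}(\mathfrak m a)\mathfrak m=f\mathfrak m f^{-1}$.
  let f : K.group b := D.meridian⁻¹ * h * e
  have hf : Λ (MonoidAlgebra.of ℤ _ a) * τ κ = U f * τ κ * ((U f)⁻¹ : (Novikov κ)ˣ) := by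
    have : FreeGroup.lift D.gen a * D.meridian = f * D.meridian * f⁻¹ := by
      have e1 : FreeGroup.lift D.gen a = D.meridian⁻¹ * (h * D'.meridian * h⁻¹) := by
        rw [← h4, inv_mul_cancel_left]
      rw [e1, he]
      simp only [f]
      group
    have := congrArg U this
    rw [map_mul, map_mul, map_mul, map_inv, hUm] at this
    simpa [hUa] using congrArg Units.val this
  obtain ⟨E, hE, hmat⟩ := foxMatrix_change_K1 isUnit_two (t := τ κ) (t₁ := tauSubOne κ) rfl hrel
    h2 h3 hf
  -- The element $h$ conjugates the words and the meridian simultaneously, so the diagonal matrix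
  -- $\rho(h)\cdot1$ conjugates the whole Alexander matrix. It is not central in general, but it
  -- enters both `L` and `M` and its class cancels.
  let N : GLn (Novikov κ) (2 * g) := Units.map (Matrix.scalar (Fin (2 * g))).toMonoidHom (U h)
  have hconj : N.val * (subst κ c).mapMatrix (D'.alexanderMatrix ρ') =
      foxMatrix (Λ.comp (groupRingMap θ.toMonoidHom)) (τ κ * Λ (MonoidAlgebra.of ℤ _ a)) D'.y D'.z
        * N.val := by
    have hw : ∀ ξ, (U h : Novikov κ) * subst κ c (D'.wordMap ρ' ξ) =
        Λ (groupRingMap θ.toMonoidHom ξ) * U h := by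
      intro ξ
      induction ξ using MonoidAlgebra.induction_on with
      | of w =>
        have e1 : subst κ c (D'.wordMap ρ' (MonoidAlgebra.of ℤ _ w)) =
            U (FreeGroup.lift D'.gen w) := by
          rw [wordMap_of, hU, ← hc]; rfl
        have e2 : Λ (groupRingMap θ.toMonoidHom (MonoidAlgebra.of ℤ _ w)) =
            U (FreeGroup.lift D.gen (θ w)) := by
          rw [groupRingMap_of, hUa]; rfl
        rw [e1, e2, h1, ← Units.val_mul, ← Units.val_mul, ← map_mul, ← map_mul,
          inv_mul_cancel_right]
      | add x y hx hy => simp only [map_add, mul_add, add_mul, hx, hy]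
      | smul r x hx => simp only [map_zsmul, mul_smul_comm, smul_mul_assoc, hx]
    have ht : (U h : Novikov κ) * subst κ c (τ (twist κ c) : Novikov (twist κ c)) =
        τ κ * Λ (MonoidAlgebra.of ℤ _ a) * U h := by
      have e1 : subst κ c (τ (twist κ c) : Novikov (twist κ c)) = U D'.meridian := by
        rw [← hρ'.map_meridian, hU, ← hc]; rfl
      rw [e1, ← hUa, ← hUm, ← Units.val_mul, ← Units.val_mul, ← Units.val_mul, ← map_mul,
        ← map_mul, ← map_mul, h4, inv_mul_cancel_right]
    ext1 j i
    change (Matrix.diagonal (fun _ => (U h : Novikov κ)) * _ : Matrix _ _ (Novikov κ)) j i =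
      (_ * Matrix.diagonal (fun _ => (U h : Novikov κ)) : Matrix _ _ (Novikov κ)) j i
    rw [Matrix.diagonal_mul, Matrix.mul_diagonal]
    change (U h : Novikov κ) * subst κ c (_ * D'.wordMap ρ' _ - D'.wordMap ρ' _) =
      (_ * Λ (groupRingMap θ.toMonoidHom _) - Λ (groupRingMap θ.toMonoidHom _)) * _
    rw [map_sub, map_mul, mul_sub, sub_mul, hw, ← mul_assoc, ht, mul_assoc, hw, mul_assoc,
      mul_assoc, mul_assoc]
  -- Here $\rho(x_i)\in A$ is used: the Jacobians come from $GL(A)$, whose classes are divided out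
  -- in `Q`.
  have hJ : ∀ (Λ₁ : MonoidAlgebra ℤ (FreeGroup (Fin (2 * g))) →+* A)
      (φ : FreeGroup (Fin (2 * g)) ≃* FreeGroup (Fin (2 * g))),
      (QuotientGroup.mk (K1.ofGL _ (jacobianUnit ((C κ).comp Λ₁) φ)) : Q κ) = 1 := fun Λ₁ φ => by
    rw [← mapGL_jacobianUnit, ← K1.map_ofGL, Q.mk_map_C]
  set J := jacobianUnit Λ θ with hJdef
  set Z := jacobianUnit (Λ.comp (groupRingMap (FreeGroup.lift D.z))) ψ with hZdef
  refine ⟨N⁻¹ * Z, N⁻¹ * J * E⁻¹, ?_, ?_⟩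
  · have e1 : (subst κ c).mapMatrix (D'.alexanderMatrix ρ') = N⁻¹.val *
        foxMatrix (Λ.comp (groupRingMap θ.toMonoidHom)) (τ κ * Λ (MonoidAlgebra.of ℤ _ a))
          D'.y D'.z * N.val := by
      rw [mul_assoc, ← hconj, ← mul_assoc, N.inv_mul, one_mul]
    have e2 : (foxMatrix (Λ.comp (groupRingMap θ.toMonoidHom)) (τ κ * Λ (MonoidAlgebra.of ℤ _ a))
        D'.y D'.z * J.val) * E⁻¹.val = Z.val * D.alexanderMatrix ρ := by
      rw [hmat, mul_assoc, E.mul_inv, mul_one]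
      rfl
    rw [e1, Units.val_mul, Units.val_mul, Units.val_mul, mul_assoc N⁻¹.val Z.val, ← e2]
    simp only [mul_assoc]
    rw [← mul_assoc N.val, N.mul_inv, one_mul]
  · have hJ1 : (QuotientGroup.mk (K1.ofGL _ J) : Q κ) = 1 := by
      rw [hJdef, hΛ₀]; exact hJ _ _
    have hZ1 : (QuotientGroup.mk (K1.ofGL _ Z) : Q κ) = 1 := by
      rw [hZdef, hΛ₀, RingHom.comp_assoc]; exact hJ _ _
    rw [map_mul, map_mul, map_mul, map_inv (K1.ofGL _) E, hE, inv_one, mul_one,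
      QuotientGroup.mk_mul, QuotientGroup.mk_mul, hJ1, hZ1]

/-- The invariant `τ^g Δ` does not depend on the system of choices. -/
theorem map_subst_τgΔ [Algebra ℚ A] {D D' : F.Generators b}
    {ρ : MonoidAlgebra ℤ (K.group b) →+* Novikov κ} (hρ : D.Adapted ρ) (c : Aˣ)
    (ρ' : MonoidAlgebra ℤ (K.group b) →+* Novikov (twist κ c)) (hρ' : D'.Adapted ρ')
    (hc : (subst κ c).comp ρ' = ρ) :
    Q.map _ (subst_comp_C κ c) (D'.τgΔ ρ') = D.τgΔ ρ := by
  obtain ⟨L, M, hLM, hcl⟩ := exists_alexanderMatrix_change hρ c ρ' hρ' hc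
  have hiff : IsUnit (D'.alexanderMatrix ρ') ↔ IsUnit (D.alexanderMatrix ρ) := by
    have e1 : IsUnit ((subst κ c).mapMatrix (D'.alexanderMatrix ρ')) ↔
        IsUnit (D'.alexanderMatrix ρ') :=
      MulEquiv.isUnit_map (f := (substEquiv κ c).mapMatrix.toMulEquiv)
    rw [← e1, ← M.isUnit_mul_units, hLM, L.isUnit_units_mul]
  by_cases hu : IsUnit (D.alexanderMatrix ρ)
  · have hu' := hiff.2 hu
    have key : K1.mapGL (subst κ c) _ hu'.unit * M = L * hu.unit := Units.ext hLM
    have key2 := congrArg (fun x => (QuotientGroup.mk (K1.ofGL _ x) : Q κ)) key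
    simp only [map_mul, QuotientGroup.mk_mul, hcl] at key2
    rw [mul_comm] at key2
    have key3 := mul_left_cancel key2
    -- The factors $\tau^g$ and $\tau^{-g}$ cancel, leaving only the classes of the two matrices.
    rw [τgΔ, τgΔ, Δ, Δ, dif_pos hu, dif_pos hu', ← QuotientGroup.mk_mul, ← QuotientGroup.mk_mul,
      ← mul_assoc, ← mul_assoc, zpow_neg, zpow_natCast, zpow_neg, zpow_natCast, mul_inv_cancel,
      mul_inv_cancel, one_mul, one_mul, Q.map_mk, K1.map_ofGL, key3]
  · have hu' := fun h => hu (hiff.1 h)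
    -- In the singular case only $\tau'^g$ remains. It maps to $(c\tau)^g$, and the class of $c\in
    -- A^\times$ is trivial in `Q`.
    have hτ : Units.map (subst κ c).toMonoidHom (τ (twist κ c)) =
        Units.map (C κ).toMonoidHom c * τ κ := Units.ext (subst_τ κ c)
    rw [τgΔ, τgΔ, Δ, Δ, dif_neg hu, dif_neg hu', mul_one, mul_one, Q.map_mk, map_pow,
      K1.map_ofUnit, hτ, map_mul, ← K1.map_ofUnit, mul_pow, ← map_pow, QuotientGroup.mk_mul,
      Q.mk_map_C, one_mul]

end SeifertSurface.Generators

end KnotLog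

end

open KnotLog in
theorem proposition4p3 {A : Type*} [Ring A] [Algebra ℚ A] (κ : RingAut A)
    (K : Knot) (b : K.Complement) {g : ℕ} (F : SeifertSurface K g)
    (D D' : F.Generators b)
    (ρ : MonoidAlgebra ℤ (K.group b) →+* Novikov κ) (hρ : D.Adapted ρ)
    (c : Aˣ) (ρ' : MonoidAlgebra ℤ (K.group b) →+* Novikov (Novikov.twist κ c))
    (hρ' : D'.Adapted ρ') (hc : (Novikov.subst κ c).comp ρ' = ρ)
    (hW : LiesInW1 κ (D.τgΔ ρ)) :
    LiesInW1 (Novikov.twist κ c) (D'.τgΔ ρ') ∧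
      ∀ k : ℕ, ∃ ℓ : Novikov.Pbar κ k, ∃ ℓ' : Novikov.Pbar (Novikov.twist κ c) k,
        (∀ l, IsLogCoeff κ k (D.τgΔ ρ) l ↔ l = ℓ) ∧
        (∀ l, IsLogCoeff (Novikov.twist κ c) k (D'.τgΔ ρ') l ↔ l = ℓ') ∧
        Novikov.Pbar.subst κ c k ℓ' = ℓ := by
  obtain ⟨_, ⟨w, rfl⟩, hw⟩ := hW
  -- The inverse substitution takes a Witt vector representing the first class to one representing
  -- the second.
  have hw' : toQ _ (wittToK1 _ (Novikov.wittSubst c w)) = D'.τgΔ ρ' := by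
    rw [← Q.map_symm_map_subst c (D'.τgΔ ρ'),
      SeifertSurface.Generators.map_subst_τgΔ hρ c ρ' hρ' hc, ← hw, Novikov.toQ_wittToK1,
      Novikov.toQ_wittToK1, Q.map_mk, K1.map_ofUnit, Novikov.wittUnit_wittSubst]
  have huniq : ∀ {κ : RingAut A} {q : Q κ} {w : Novikov.witt κ} (k : ℕ),
      toQ κ (wittToK1 κ w) = q → ∀ l, IsLogCoeff κ k q l ↔ l = Novikov.logCoeff k w := by
    rintro κ _ w k rfl l
    constructor
    · rintro ⟨v, hv, rfl⟩
      exact Novikov.logCoeff_eq_of_toQ_eq hv k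
    · rintro rfl
      exact ⟨w, rfl, rfl⟩
  exact ⟨⟨_, ⟨_, rfl⟩, hw'⟩, fun k => ⟨_, _, huniq k hw, huniq k hw',
    Novikov.subst_logCoeff_wittSubst c k w⟩⟩
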